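/- Let $d\ge 1$. For a bounded domain $\Omega\subset\mathbb{R}^d$ let $$\beta(\Omega)=\inf_{q\in L^2_\circ(\Omega)\setminus\{0\}}\ \sup_{v\in H^1_0(\Omega)^d\setminus\{0\}}\frac{\langle \operatorname{div} v,q\rangle_\Omega}{|v|_{1,\Omega}\,\|q\|_{0,\Omega}}$$ be the inf-sup (LBB) constant of the divergence. Here $L^2_\circ(\Omega)$ is the space of functions in $L^2(\Omega)$ with mean value zero, $\langle\cdot,\cdot\rangle_\Omega$ and $\|\cdot\|_{0,\Omega}$ are the scalar product and the norm of $L^2(\Omega)$, $H^1_0(\Omega)$ is the closure in $H^1(\Omega)$ of the smooth functions with compact support in $\Omega$, and $|v|_{1,\Omega}=\big(\sum_{k,j=1}^d\|\partial_{x_j}v_k\|_{0,\Omega}^2\big)^{1/2}$. For $\varepsilon>0$, two bounded Lipschitz domains $\Omega,\widetilde\Omega\subset\mathbb{R}^d$ are called $\varepsilon$-close in Lipschitz norm if there is a Lipschitz diffeomorphism $F$ from $\widetilde\Omega$ onto $\Omega$, that is, a homeomorphism with $F\in W^{1,\infty}(\widetilde\Omega)^d$ and $F^{-1}\in W^{1,\infty}(\Omega)^d$,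 such that $$\|DF-\mathrm{I}_d\|_{L^\infty(\widetilde\Omega)}\le\varepsilon\qquad\text{and}\qquad \|DF^{-1}-\mathrm{I}_d\|_{L^\infty(\Omega)}\le\varepsilon,$$ where matrices carry the operator norm subordinate to the Euclidean norm of $\mathbb{R}^d$. Theorem. There is a constant $c(d)$ depending only on the dimension $d$ such that, for every $\varepsilon>0$ and all bounded Lipschitz domains $\Omega,\widetilde\Omega\subset\mathbb{R}^d$ that are $\varepsilon$-close in Lipschitz norm, $$|\beta(\Omega)-\beta(\widetilde\Omega)|\le c(d)\,\varepsilon .$$ -/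

import Mathlib

open MeasureTheory Filter Topology
open scoped ContDiff NNReal ENNReal

noncomputable section

namespace LBB

/-- The Euclidean space `ℝ^d`. -/
abbrev Space (d : ℕ) : Type := EuclideanSpace ℝ (Fin d)

/-- The `j`-th vector of the canonical basis of `ℝ^d`. -/
abbrev basisVec {d : ℕ} (j : Fin d) : Space d := EuclideanSpace.single j (1 : ℝ)

/-- Bounded Lipschitz domains: nonempty connected bounded open sets which, near each boundary
point and in suitable orthonormal coordinates with last axis `n`, are the strict epigraph of a
Lipschitz function of the orthogonal projection `y - ⟪n, y⟫ n` on the hyperplane `n^⊥`. -/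
structure IsBoundedLipschitzDomain {d : ℕ} (Ω : Set (Space d)) : Prop where
  isOpen : IsOpen Ω
  isConnected : IsConnected Ω
  isBounded : Bornology.IsBounded Ω
  lipschitz_boundary : ∀ x ∈ frontier Ω, ∃ U : Set (Space d), IsOpen U ∧ x ∈ U ∧
    ∃ n : Space d, ‖n‖ = 1 ∧ ∃ (K : ℝ≥0) (γ : Space d → ℝ), LipschitzWith K γ ∧
      Ω ∩ U = {y ∈ U | γ (y - inner ℝ n y • n) < inner ℝ n y}

/-- Smooth functions with compact support contained in `Ω`. -/
structure IsTestFunction {d : ℕ} {V : Type*} [NormedAddCommGroup V] [NormedSpace ℝ V]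
    (Ω : Set (Space d)) (φ : Space d → V) : Prop where
  contDiff : ContDiff ℝ ∞ φ
  hasCompactSupport : HasCompactSupport φ
  tsupport_subset : tsupport φ ⊆ Ω

/-- `G` is the weak (distributional) Jacobian of the vector field `v` on `Ω`: both are locally
integrable on `Ω`, and the `i`-th component of `G x e_j` is the weak partial derivative
`∂_j v_i`. -/
structure IsWeakJacobian {d : ℕ} (Ω : Set (Space d)) (v : Space d → Space d)
    (G : Space d → Space d →L[ℝ] Space d) : Prop where
  locallyIntegrableOn : LocallyIntegrableOn v Ω
  locallyIntegrableOn_jacobian : LocallyIntegrableOn G Ω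
  integral_eq : ∀ φ : Space d → ℝ, IsTestFunction Ω φ → ∀ i j : Fin d,
    ∫ x in Ω, v x i * fderiv ℝ φ x (basisVec j) = - ∫ x in Ω, G x (basisVec j) i * φ x

/-- `v` belongs to `W^{1,∞}(Ω)^d`, and its weak Jacobian is `G`. -/
structure IsW1Infty {d : ℕ} (Ω : Set (Space d)) (v : Space d → Space d)
    (G : Space d → Space d →L[ℝ] Space d) : Prop where
  isWeakJacobian : IsWeakJacobian Ω v G
  memLp : MemLp v ∞ (volume.restrict Ω)
  memLp_jacobian : MemLp G ∞ (volume.restrict Ω)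

/-- `v` belongs to `H^1_0(Ω)^d`, and its weak Jacobian is `G`: the field `v` is in `H^1(Ω)^d`
and is the limit in `H^1(Ω)^d` of smooth fields with compact support in `Ω`. -/
structure IsH10 {d : ℕ} (Ω : Set (Space d)) (v : Space d → Space d)
    (G : Space d → Space d →L[ℝ] Space d) : Prop where
  isWeakJacobian : IsWeakJacobian Ω v G
  memLp : MemLp v 2 (volume.restrict Ω)
  memLp_jacobian : MemLp G 2 (volume.restrict Ω)
  exists_approx : ∃ φ : ℕ → Space d → Space d, (∀ n, IsTestFunction Ω (φ n)) ∧
    Tendsto (fun n => eLpNorm (φ n - v) 2 (volume.restrict Ω)) atTop (𝓝 0) ∧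
    Tendsto (fun n => eLpNorm (fderiv ℝ (φ n) - G) 2 (volume.restrict Ω)) atTop (𝓝 0)

/-- The `H^1` seminorm on `Ω` of a field with Jacobian `G`, that is
`(∑_k ∑_j ‖∂_j v_k‖²)^{1/2}` with the norm of `L²(Ω)`. -/
def h1Seminorm {d : ℕ} (Ω : Set (Space d)) (G : Space d → Space d →L[ℝ] Space d) : ℝ :=
  Real.sqrt (∑ k : Fin d, ∑ j : Fin d, ∫ x in Ω, (G x (basisVec j) k) ^ 2)

/-- The divergence of a field with Jacobian `G`. -/
def divergence {d : ℕ} (G : Space d → Space d →L[ℝ] Space d) (x : Space d) : ℝ :=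
  ∑ k : Fin d, G x (basisVec k) k

/-- `q` belongs to `L²_∘(Ω)`: it is square integrable on `Ω` with mean value zero. -/
structure IsL2MeanZero {d : ℕ} (Ω : Set (Space d)) (q : Space d → ℝ) : Prop where
  memLp : MemLp q 2 (volume.restrict Ω)
  integral_eq_zero : ∫ x in Ω, q x = 0

/-- The norm of `L²(Ω)`. -/
def l2Norm {d : ℕ} (Ω : Set (Space d)) (q : Space d → ℝ) : ℝ :=
  Real.sqrt (∫ x in Ω, (q x) ^ 2)

/-- The set of the quotients `⟨div v, q⟩ / (|v|₁ ‖q‖)`, for `v` in `H^1_0(Ω)^d`, `v ≠ 0`. -/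
def quotients {d : ℕ} (Ω : Set (Space d)) (q : Space d → ℝ) : Set ℝ :=
  {r | ∃ (v : Space d → Space d) (G : Space d → Space d →L[ℝ] Space d),
    IsH10 Ω v G ∧ h1Seminorm Ω G ≠ 0 ∧
      r = (∫ x in Ω, divergence G x * q x) / (h1Seminorm Ω G * l2Norm Ω q)}

theorem memLp_entry {d : ℕ} {Ω : Set (Space d)} {G : Space d → Space d →L[ℝ] Space d} {p : ℝ≥0∞}
    (hG : MemLp G p (volume.restrict Ω)) (j k : Fin d) :
    MemLp (fun x => G x (basisVec j) k) p (volume.restrict Ω) :=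
  ((EuclideanSpace.proj k : Space d →L[ℝ] ℝ).comp
    (ContinuousLinearMap.apply ℝ (Space d) (basisVec j))).comp_memLp' hG

/-- The supremum in the definition of `β` is a supremum of a bounded set of real numbers. -/
theorem bddAbove_quotients {d : ℕ} {Ω : Set (Space d)} {q : Space d → ℝ}
    (hq : MemLp q 2 (volume.restrict Ω)) : BddAbove (quotients Ω q) := by
  refine ⟨Real.sqrt d, ?_⟩
  rintro r ⟨v, G, hv, h0, rfl⟩
  have hE := fun j k => memLp_entry hv.memLp_jacobian j k
  have hdiv : MemLp (divergence G) 2 (volume.restrict Ω) := by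
    unfold divergence
    exact memLp_finsetSum _ fun k _ => hE k k
  have hcs : ∫ x in Ω, divergence G x * q x ≤
      Real.sqrt (∫ x in Ω, divergence G x ^ 2) * Real.sqrt (∫ x in Ω, q x ^ 2) := by
    have h1 := integral_mul_norm_le_Lp_mul_Lq (μ := volume.restrict Ω) (f := divergence G) (g := q)
      (p := 2) (q := 2) (by constructor <;> norm_num) (by simpa using hdiv) (by simpa using hq)
    have h2 : ∫ x in Ω, divergence G x * q x ≤ ∫ x in Ω, ‖divergence G x‖ * ‖q x‖ := by
      refine integral_mono (hdiv.integrable_mul hq) (hdiv.norm.integrable_mul hq.norm) fun x => ?_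
      simpa [abs_mul] using le_abs_self (divergence G x * q x)
    refine h2.trans (h1.trans_eq ?_)
    simp [Real.sqrt_eq_rpow]
  have hle : ∫ x in Ω, divergence G x ^ 2 ≤
      d * ∑ k : Fin d, ∑ j : Fin d, ∫ x in Ω, (G x (basisVec j) k) ^ 2 := by
    have hi := fun j k => (hE j k).integrable_sq
    have : (d : ℝ) * ∑ k : Fin d, ∑ j : Fin d, ∫ x in Ω, (G x (basisVec j) k) ^ 2 =
        ∫ x in Ω, d * ∑ k : Fin d, ∑ j : Fin d, (G x (basisVec j) k) ^ 2 := by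
      rw [integral_const_mul, integral_finsetSum _ fun k _ => integrable_finsetSum _ fun j _ => hi j k]
      congr 1
      exact Finset.sum_congr rfl fun k _ => (integral_finsetSum _ fun j _ => hi j k).symm
    rw [this]
    refine integral_mono hdiv.integrable_sq ((integrable_finsetSum _ fun k _ =>
      integrable_finsetSum _ fun j _ => hi j k).const_mul _) fun x => ?_
    have h1 := sq_sum_le_card_mul_sum_sq (s := (Finset.univ : Finset (Fin d)))
      (f := fun k => G x (basisVec k) k)
    simp only [Finset.card_univ, Fintype.card_fin] at h1
    refine h1.trans (mul_le_mul_of_nonneg_left (Finset.sum_le_sum fun k _ => ?_) (by positivity))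
    exact Finset.single_le_sum (f := fun j => (G x (basisVec j) k) ^ 2)
      (fun j _ => sq_nonneg _) (Finset.mem_univ k)
  have hpos : 0 < h1Seminorm Ω G := lt_of_le_of_ne (Real.sqrt_nonneg _) h0.symm
  have hs : Real.sqrt (∫ x in Ω, divergence G x ^ 2) ≤ Real.sqrt d * h1Seminorm Ω G := by
    rw [h1Seminorm, ← Real.sqrt_mul (by positivity)]
    exact Real.sqrt_le_sqrt hle
  have hl : 0 ≤ l2Norm Ω q := Real.sqrt_nonneg _
  refine div_le_of_le_mul₀ (by positivity) (by positivity) ?_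
  calc _ ≤ _ := hcs
    _ ≤ (Real.sqrt d * h1Seminorm Ω G) * l2Norm Ω q := mul_le_mul_of_nonneg_right hs hl
    _ = _ := by ring

/-- The inf-sup constant of the divergence
`β(Ω) = inf_{q ∈ L²_∘(Ω), q ≠ 0} sup_{v ∈ H^1_0(Ω)^d, v ≠ 0} ⟨div v, q⟩ / (|v|₁ ‖q‖)`. -/
def beta {d : ℕ} (Ω : Set (Space d)) : ℝ :=
  sInf {s | ∃ q : Space d → ℝ, IsL2MeanZero Ω q ∧ l2Norm Ω q ≠ 0 ∧ s = sSup (quotients Ω q)}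

/-- `Ω` and `Ω'` are `ε`-close in Lipschitz norm: there is a homeomorphism `F` from `Ω'` onto `Ω`
such that `F` and its inverse are of class `W^{1,∞}` with weak Jacobians at distance at most `ε`
from the identity in `L^∞`, for the operator norm subordinate to the Euclidean norm. -/
def LipschitzClose {d : ℕ} (ε : ℝ) (Ω Ω' : Set (Space d)) : Prop :=
  ∃ (F : OpenPartialHomeomorph (Space d) (Space d))
    (DF DFinv : Space d → Space d →L[ℝ] Space d),
    F.source = Ω' ∧ F.target = Ω ∧
    IsW1Infty Ω' F DF ∧
    eLpNorm (fun x => DF x - ContinuousLinearMap.id ℝ (Space d)) ∞ (volume.restrict Ω')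
      ≤ ENNReal.ofReal ε ∧
    IsW1Infty Ω F.symm DFinv ∧
    eLpNorm (fun x => DFinv x - ContinuousLinearMap.id ℝ (Space d)) ∞ (volume.restrict Ω)
      ≤ ENNReal.ofReal ε

end LBB

end

/-! Write `F` for the homeomorphism from the source to the target, `L = 1 + ε`, and compare the two
infima by transport. A mean-zero `q'` on the source is carried to `q = ρ · (q' ∘ F⁻¹)` on the
target, where `ρ` is the density of the image of Lebesgue measure under `F`. Then `∫ f q = ∫ (f ∘ F)
q'` for continuous `f`, so the mean stays zero, and `L⁻ᵈ ≤ ρ ≤ Lᵈ` controls the norms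
(`exists_transport`).

A test field `φ` on the target is pulled back to `φ ∘ F`, which lies in `H^1_0` of the source with
Jacobian `A ∘ DF`, where `A = Dφ ∘ F` (`isH10_comp`). Since `tr A = tr (A ∘ DF) - tr (A ∘ (DF -
I))`, the pairing of `div φ` with `q` is that of an admissible source field with `q'`, up to an
error of size `√d ε` times `‖A‖ ‖q'‖` in `L²`. Hence the supremum for `q` is at most `(S L + √d ε)
Lᵈ`, with `S ≤ √d` the supremum for `q'`; for `ε ≤ 1` this exceeds `S` by at most `c ε`
(`beta_target_le`). Exchanging `F` and its inverse gives the other side. For `ε ≥ 1` the bound `0 ≤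
β ≤ √d` suffices.

Neither Rademacher's theorem nor the area formula is used: mollification gives local Lipschitz
bounds and the chain rule, and Hausdorff measure gives the bounds on `ρ`, which is never identified
with a determinant. -/

noncomputable section

namespace LBB

open Metric

/-! ### Linear algebra: trace and Frobenius norm. -/

section

variable {d : ℕ}

/-- The squared Frobenius norm of a linear map. -/
def frobSq (A : Space d →L[ℝ] Space d) : ℝ := ∑ k : Fin d, ∑ j : Fin d, (A (basisVec j) k) ^ 2

/-- The trace of a linear map in the canonical basis. -/
def tr (A : Space d →L[ℝ] Space d) : ℝ := ∑ k : Fin d, A (basisVec k) k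

theorem frobSq_nonneg (A : Space d →L[ℝ] Space d) : 0 ≤ frobSq A := by
  unfold frobSq; positivity

theorem sum_sq_row (A : Space d →L[ℝ] Space d) (k : Fin d) :
    ∑ j : Fin d, (A (basisVec j) k) ^ 2 = ‖ContinuousLinearMap.adjoint A (basisVec k)‖ ^ 2 := by
  rw [EuclideanSpace.norm_sq_eq]
  refine Finset.sum_congr rfl fun j _ => ?_
  have : (ContinuousLinearMap.adjoint A (basisVec k)) j = A (basisVec j) k := by
    have h1 := ContinuousLinearMap.adjoint_inner_right A (basisVec j) (basisVec k)
    simpa [EuclideanSpace.inner_single_left, EuclideanSpace.inner_single_right] using h1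
  rw [this, Real.norm_eq_abs, sq_abs]

/-- Row `k` of a product is the adjoint of `B` applied to row `k` of `A`, so each row grows at most
by the operator norm of `B`. Only the operator norm of the right factor enters, which is the norm in
which `DF - I` is small. -/
theorem frobSq_comp_le (A B : Space d →L[ℝ] Space d) : frobSq (A ∘L B) ≤ ‖B‖ ^ 2 * frobSq A := by
  unfold frobSq
  rw [Finset.mul_sum]
  refine Finset.sum_le_sum fun k _ => ?_
  rw [sum_sq_row, sum_sq_row, ContinuousLinearMap.adjoint_comp, ← mul_pow]
  refine pow_le_pow_left₀ (norm_nonneg _) ?_ 2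
  rw [← LinearIsometryEquiv.norm_map
    (ContinuousLinearMap.adjoint (𝕜 := ℝ) (E := Space d) (F := Space d)) B]
  exact (ContinuousLinearMap.adjoint B).le_opNorm (ContinuousLinearMap.adjoint A (basisVec k))

theorem tr_sq_le (A : Space d →L[ℝ] Space d) : tr A ^ 2 ≤ d * frobSq A := by
  have h1 := sq_sum_le_card_mul_sum_sq (s := (Finset.univ : Finset (Fin d)))
    (f := fun k => A (basisVec k) k)
  simp only [Finset.card_univ, Fintype.card_fin] at h1
  refine h1.trans (mul_le_mul_of_nonneg_left (Finset.sum_le_sum fun k _ => ?_) (by positivity))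
  exact Finset.single_le_sum (f := fun j => (A (basisVec j) k) ^ 2)
    (fun j _ => sq_nonneg _) (Finset.mem_univ k)

theorem abs_tr_le (A : Space d →L[ℝ] Space d) : |tr A| ≤ √d * √(frobSq A) := by
  rw [← Real.sqrt_mul (by positivity)]
  exact Real.abs_le_sqrt (tr_sq_le A)

theorem abs_tr_comp_le (A B : Space d →L[ℝ] Space d) :
    |tr (A ∘L B)| ≤ √d * ‖B‖ * √(frobSq A) := by
  refine (abs_tr_le _).trans ?_
  rw [mul_assoc]
  gcongr
  refine (Real.sqrt_le_sqrt (frobSq_comp_le A B)).trans_eq ?_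
  rw [Real.sqrt_mul (by positivity), Real.sqrt_sq (norm_nonneg _)]

theorem tr_sub (A B : Space d →L[ℝ] Space d) : tr (A - B) = tr A - tr B := by
  simp [tr, Finset.sum_sub_distrib]

theorem continuous_tr : Continuous (tr : (Space d →L[ℝ] Space d) → ℝ) := by
  unfold tr
  refine continuous_finsetSum _ fun k _ => ?_
  exact ((EuclideanSpace.proj k : Space d →L[ℝ] ℝ).comp
    (ContinuousLinearMap.apply ℝ (Space d) (basisVec k))).continuous

theorem continuous_frobSq : Continuous (frobSq : (Space d →L[ℝ] Space d) → ℝ) := by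
  unfold frobSq
  refine continuous_finsetSum _ fun k _ => continuous_finsetSum _ fun j _ => ?_
  exact (((EuclideanSpace.proj k : Space d →L[ℝ] ℝ).comp
    (ContinuousLinearMap.apply ℝ (Space d) (basisVec j))).continuous).pow 2

/-! ### The pairing, the seminorm, and elementary bounds on `beta`. -/

theorem integral_frobSq {Ω : Set (Space d)} {G : Space d → Space d →L[ℝ] Space d}
    (hG : MemLp G 2 (volume.restrict Ω)) : ∫ x in Ω, frobSq (G x) =
      ∑ k : Fin d, ∑ j : Fin d, ∫ x in Ω, (G x (basisVec j) k) ^ 2 := by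
  have hi := fun j k => (memLp_entry hG j k).integrable_sq
  unfold frobSq
  rw [integral_finsetSum _ fun k _ => integrable_finsetSum _ fun j _ => hi j k]
  exact Finset.sum_congr rfl fun k _ => integral_finsetSum _ fun j _ => hi j k

theorem h1Seminorm_eq {Ω : Set (Space d)} {G : Space d → Space d →L[ℝ] Space d}
    (hG : MemLp G 2 (volume.restrict Ω)) : h1Seminorm Ω G = √(∫ x in Ω, frobSq (G x)) := by
  rw [h1Seminorm, integral_frobSq hG]

theorem integrable_frobSq {Ω : Set (Space d)} {G : Space d → Space d →L[ℝ] Space d}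
    (hG : MemLp G 2 (volume.restrict Ω)) : Integrable (fun x => frobSq (G x)) (volume.restrict Ω) :=
  integrable_finsetSum _ fun k _ => integrable_finsetSum _ fun j _ =>
    (memLp_entry hG j k).integrable_sq

theorem memLp_sqrt_frobSq {Ω : Set (Space d)} {G : Space d → Space d →L[ℝ] Space d}
    (hG : MemLp G 2 (volume.restrict Ω)) :
    MemLp (fun x => √(frobSq (G x))) 2 (volume.restrict Ω) := by
  rw [memLp_two_iff_integrable_sq
    (((continuous_frobSq.sqrt).comp_aestronglyMeasurable hG.aestronglyMeasurable))]
  simpa only [Real.sq_sqrt (frobSq_nonneg _)] using integrable_frobSq hG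

theorem memLp_divergence {Ω : Set (Space d)} {G : Space d → Space d →L[ℝ] Space d} {p : ℝ≥0∞}
    (hG : MemLp G p (volume.restrict Ω)) : MemLp (divergence G) p (volume.restrict Ω) := by
  unfold divergence
  exact memLp_finsetSum _ fun k _ => memLp_entry hG k k

/-- The Cauchy–Schwarz inequality for real functions. -/
theorem integral_mul_le_sqrt {α : Type*} [MeasurableSpace α] {μ : Measure α} {f g : α → ℝ}
    (hf : MemLp f 2 μ) (hg : MemLp g 2 μ) :
    ∫ x, |f x| * |g x| ∂μ ≤ √(∫ x, f x ^ 2 ∂μ) * √(∫ x, g x ^ 2 ∂μ) := by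
  have h1 := integral_mul_norm_le_Lp_mul_Lq (μ := μ) (f := f) (g := g)
      (p := 2) (q := 2) (by constructor <;> norm_num) (by simpa using hf) (by simpa using hg)
  simpa [Real.sqrt_eq_rpow] using h1

theorem integral_divergence_mul_le {Ω : Set (Space d)} {G : Space d → Space d →L[ℝ] Space d}
    {q : Space d → ℝ} (hG : MemLp G 2 (volume.restrict Ω)) (hq : MemLp q 2 (volume.restrict Ω)) :
    |∫ x in Ω, divergence G x * q x| ≤ √d * (h1Seminorm Ω G * l2Norm Ω q) := by
  have hdiv := memLp_divergence hG
  calc |∫ x in Ω, divergence G x * q x| ≤ ∫ x in Ω, |divergence G x| * |q x| := by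
        simpa [abs_mul] using
          abs_integral_le_integral_abs (μ := volume.restrict Ω) (f := fun x => divergence G x * q x)
    _ ≤ √(∫ x in Ω, divergence G x ^ 2) * √(∫ x in Ω, q x ^ 2) := integral_mul_le_sqrt hdiv hq
    _ ≤ (√d * h1Seminorm Ω G) * l2Norm Ω q := by
        rw [h1Seminorm_eq hG, ← Real.sqrt_mul d.cast_nonneg, l2Norm]
        refine mul_le_mul_of_nonneg_right (Real.sqrt_le_sqrt ?_) (Real.sqrt_nonneg _)
        rw [← integral_const_mul]
        exact integral_mono hdiv.integrable_sq ((integrable_frobSq hG).const_mul _)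
          fun x => tr_sq_le (G x)
    _ = _ := by ring

theorem h1Seminorm_nonneg {Ω : Set (Space d)} {G : Space d → Space d →L[ℝ] Space d} :
    0 ≤ h1Seminorm Ω G := Real.sqrt_nonneg _

theorem l2Norm_nonneg {Ω : Set (Space d)} {q : Space d → ℝ} : 0 ≤ l2Norm Ω q := Real.sqrt_nonneg _

theorem sSup_quotients_le {Ω : Set (Space d)} {q : Space d → ℝ} (hq : MemLp q 2 (volume.restrict Ω)) :
    sSup (quotients Ω q) ≤ √d := by
  refine Real.sSup_le ?_ (Real.sqrt_nonneg _)
  rintro r ⟨v, G, hv, h0, rfl⟩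
  exact div_le_of_le_mul₀ (mul_nonneg h1Seminorm_nonneg l2Norm_nonneg) (Real.sqrt_nonneg _)
    ((le_abs_self _).trans (integral_divergence_mul_le hv.memLp_jacobian hq))

theorem IsTestFunction.neg {V : Type*} [NormedAddCommGroup V] [NormedSpace ℝ V] {Ω : Set (Space d)}
    {φ : Space d → V} (h : IsTestFunction Ω φ) : IsTestFunction Ω (-φ) where
  contDiff := h.contDiff.neg
  hasCompactSupport := h.hasCompactSupport.neg
  tsupport_subset := by
    have : tsupport (-φ) = tsupport φ := by simp [tsupport, Function.support_neg]
    rw [this]; exact h.tsupport_subset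

theorem IsH10.neg {Ω : Set (Space d)} {v : Space d → Space d}
    {G : Space d → Space d →L[ℝ] Space d} (h : IsH10 Ω v G) : IsH10 Ω (-v) (-G) where
  isWeakJacobian :=
    { locallyIntegrableOn := h.isWeakJacobian.locallyIntegrableOn.neg
      locallyIntegrableOn_jacobian := h.isWeakJacobian.locallyIntegrableOn_jacobian.neg
      integral_eq := fun φ hφ i j => by
        have := h.isWeakJacobian.integral_eq φ hφ i j
        simp [integral_neg, this] }
  memLp := h.memLp.neg
  memLp_jacobian := h.memLp_jacobian.neg
  exists_approx := by
    obtain ⟨φ, hφ, h1, h2⟩ := h.exists_approx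
    refine ⟨fun n => -φ n, fun n => (hφ n).neg, ?_, ?_⟩
    · refine h1.congr fun n => ?_
      rw [← eLpNorm_neg, neg_sub, neg_sub_neg]
    · refine h2.congr fun n => ?_
      rw [← eLpNorm_neg, neg_sub, show fderiv ℝ (-φ n) = -fderiv ℝ (φ n) by
        ext1 x; exact fderiv_neg, neg_sub_neg]

/-- Replacing `v` by `-v` changes the sign of a quotient, so the supremum dominates some `r` and
`-r`. If there are no quotients, the convention `sSup ∅ = 0` applies. -/
theorem sSup_quotients_nonneg {Ω : Set (Space d)} {q : Space d → ℝ}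
    (hq : MemLp q 2 (volume.restrict Ω)) : 0 ≤ sSup (quotients Ω q) := by
  rcases (quotients Ω q).eq_empty_or_nonempty with h | ⟨r, hr⟩
  · simp [h]
  have hb := bddAbove_quotients hq
  have hr' : -r ∈ quotients Ω q := by
    obtain ⟨v, G, hv, h0, rfl⟩ := hr
    have hs : h1Seminorm Ω (-G) = h1Seminorm Ω G := by simp [h1Seminorm]
    refine ⟨-v, -G, hv.neg, by rwa [hs], ?_⟩
    rw [hs, ← neg_div, ← integral_neg]
    simp [divergence]
  have h1 := le_csSup hb hr
  have h2 := le_csSup hb hr'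
  linarith

/-- The pairing is bounded by the supremum of the quotients, also for fields of seminorm zero. -/
theorem integral_divergence_mul_le_sSup {Ω : Set (Space d)} {q : Space d → ℝ}
    (hq : MemLp q 2 (volume.restrict Ω)) {v : Space d → Space d}
    {G : Space d → Space d →L[ℝ] Space d} (h : IsH10 Ω v G) :
    ∫ x in Ω, divergence G x * q x ≤ sSup (quotients Ω q) * (h1Seminorm Ω G * l2Norm Ω q) := by
  -- When the denominator vanishes, Cauchy–Schwarz forces the pairing to vanish too.
  by_cases h0 : h1Seminorm Ω G * l2Norm Ω q = 0
  · have := (le_abs_self _).trans (integral_divergence_mul_le h.memLp_jacobian hq)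
    simpa [h0] using this
  · have h1 := le_csSup (bddAbove_quotients hq) ⟨v, G, h, left_ne_zero_of_mul h0, rfl⟩
    rwa [div_le_iff₀] at h1
    exact lt_of_le_of_ne (mul_nonneg h1Seminorm_nonneg l2Norm_nonneg) (Ne.symm h0)

theorem beta_nonneg (Ω : Set (Space d)) : 0 ≤ beta Ω := by
  refine Real.sInf_nonneg ?_
  rintro s ⟨q, hq, -, rfl⟩
  exact sSup_quotients_nonneg hq.memLp

theorem beta_le_sSup {Ω : Set (Space d)} {q : Space d → ℝ} (hq : IsL2MeanZero Ω q)
    (h0 : l2Norm Ω q ≠ 0) : beta Ω ≤ sSup (quotients Ω q) := by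
  refine csInf_le ⟨0, ?_⟩ ⟨q, hq, h0, rfl⟩
  rintro s ⟨q, hq, -, rfl⟩
  exact sSup_quotients_nonneg hq.memLp

theorem beta_le (Ω : Set (Space d)) : beta Ω ≤ √d := by
  by_cases h : ∃ q, IsL2MeanZero Ω q ∧ l2Norm Ω q ≠ 0
  · obtain ⟨q, hq, h0⟩ := h
    exact (beta_le_sSup hq h0).trans (sSup_quotients_le hq.memLp)
  -- Without admissible `q`, the convention `sInf ∅ = 0` gives `beta Ω = 0`.
  · have : {s | ∃ q : Space d → ℝ, IsL2MeanZero Ω q ∧ l2Norm Ω q ≠ 0 ∧ s = sSup (quotients Ω q)}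
        = ∅ := by
      ext s; simp only [Set.mem_ofPred_eq, Set.mem_empty_iff_false, iff_false]
      rintro ⟨q, hq, h0, -⟩
      exact h ⟨q, hq, h0⟩
    rw [beta, this, Real.sInf_empty]
    exact Real.sqrt_nonneg _

/-! ### From test functions to `H^1_0`. -/

/-- Products of `L²`-convergent sequences have convergent integrals. -/
theorem tendsto_integral_mul {α : Type*} [MeasurableSpace α] {μ : Measure α} {f g : ℕ → α → ℝ}
    {f₀ g₀ : α → ℝ} (hf : ∀ n, MemLp (f n) 2 μ) (hg : ∀ n, MemLp (g n) 2 μ) (hf₀ : MemLp f₀ 2 μ)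
    (hg₀ : MemLp g₀ 2 μ) (hfl : Tendsto (fun n => eLpNorm (f n - f₀) 2 μ) atTop (𝓝 0))
    (hgl : Tendsto (fun n => eLpNorm (g n - g₀) 2 μ) atTop (𝓝 0)) :
    Tendsto (fun n => ∫ x, f n x * g n x ∂μ) atTop (𝓝 (∫ x, f₀ x * g₀ x ∂μ)) := by
  -- As inner products in `L²`, the integrals converge by continuity of the inner product.
  have key : ∀ {u w : α → ℝ} (hu : MemLp u 2 μ) (hw : MemLp w 2 μ),
      inner ℝ (hw.toLp w) (hu.toLp u) = ∫ x, u x * w x ∂μ := by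
    intro u w hu hw
    rw [L2.inner_def]
    refine integral_congr_ae ?_
    filter_upwards [hu.coeFn_toLp, hw.coeFn_toLp] with x h1 h2
    simp [h1, h2]
  rw [← key hf₀ hg₀]
  simp_rw [← fun n => key (hf n) (hg n)]
  exact ((Lp.tendsto_Lp_iff_tendsto_eLpNorm'' g hg g₀ hg₀).2 hgl).inner
    ((Lp.tendsto_Lp_iff_tendsto_eLpNorm'' f hf f₀ hf₀).2 hfl)

theorem tendsto_eLpNorm_clm_comp {α : Type*} [MeasurableSpace α] {μ : Measure α}
    {V W : Type*} [NormedAddCommGroup V] [NormedSpace ℝ V] [NormedAddCommGroup W] [NormedSpace ℝ W]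
    (T : V →L[ℝ] W) {f : ℕ → α → V} {f₀ : α → V}
    (h : Tendsto (fun n => eLpNorm (f n - f₀) 2 μ) atTop (𝓝 0)) :
    Tendsto (fun n => eLpNorm ((fun x => T (f n x)) - fun x => T (f₀ x)) 2 μ) atTop (𝓝 0) := by
  have h1 : Tendsto (fun n => ENNReal.ofReal ‖T‖ * eLpNorm (f n - f₀) 2 μ) atTop (𝓝 0) := by
    have := ENNReal.Tendsto.const_mul (a := ENNReal.ofReal ‖T‖) h (Or.inr ENNReal.ofReal_ne_top)
    rwa [mul_zero] at this
  refine tendsto_of_tendsto_of_tendsto_of_le_of_le tendsto_const_nhds h1 (fun _ => zero_le)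
    fun n => ?_
  refine eLpNorm_le_mul_eLpNorm_of_ae_le_mul (Eventually.of_forall fun x => ?_) 2
  simpa [← map_sub] using T.le_opNorm (f n x - f₀ x)

/-- An inequality between the pairing and the seminorm extends from test functions to `H^1_0`. -/
theorem integral_divergence_mul_le_of_test {Ω : Set (Space d)} {q : Space d → ℝ} {T : ℝ}
    (hq : MemLp q 2 (volume.restrict Ω))
    (hT : ∀ φ : Space d → Space d, IsTestFunction Ω φ →
      ∫ x in Ω, divergence (fderiv ℝ φ) x * q x ≤ T * h1Seminorm Ω (fderiv ℝ φ))
    {v : Space d → Space d} {G : Space d → Space d →L[ℝ] Space d} (h : IsH10 Ω v G) :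
    ∫ x in Ω, divergence G x * q x ≤ T * h1Seminorm Ω G := by
  -- Both sides depend on the Jacobian alone, continuously in `L²`; convergence of the fields
  -- themselves plays no role.
  obtain ⟨φ, hφ, -, h2⟩ := h.exists_approx
  have hm : ∀ n, MemLp (fderiv ℝ (φ n)) 2 (volume.restrict Ω) := fun n =>
    (((hφ n).contDiff.continuous_fderiv (by simp)).memLp_of_hasCompactSupport
      ((hφ n).hasCompactSupport.fderiv ℝ)).restrict _
  let e : Fin d → Fin d → (Space d →L[ℝ] Space d) →L[ℝ] ℝ := fun j k =>
    (EuclideanSpace.proj k : Space d →L[ℝ] ℝ).comp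
      (ContinuousLinearMap.apply ℝ (Space d) (basisVec j))
  have he : ∀ j k, Tendsto (fun n => eLpNorm ((fun x => fderiv ℝ (φ n) x (basisVec j) k) -
      fun x => G x (basisVec j) k) 2 (volume.restrict Ω)) atTop (𝓝 0) := fun j k =>
    tendsto_eLpNorm_clm_comp (e j k) h2
  have h0 : Tendsto (fun n : ℕ => eLpNorm (q - q) 2 (volume.restrict Ω)) atTop (𝓝 0) := by simp
  have l1 : Tendsto (fun n => ∫ x in Ω, divergence (fderiv ℝ (φ n)) x * q x) atTop
      (𝓝 (∫ x in Ω, divergence G x * q x)) := by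
    have : ∀ H, MemLp H 2 (volume.restrict Ω) → ∫ x in Ω, divergence H x * q x =
        ∑ k : Fin d, ∫ x in Ω, H x (basisVec k) k * q x := by
      intro H hH
      simp only [divergence, Finset.sum_mul]
      exact integral_finsetSum _ fun k _ => (memLp_entry hH k k).integrable_mul hq
    rw [this G h.memLp_jacobian]
    simp_rw [fun n => this _ (hm n)]
    exact tendsto_finsetSum _ fun k _ => tendsto_integral_mul (fun n => memLp_entry (hm n) k k)
      (fun _ => hq) (memLp_entry h.memLp_jacobian k k) hq (he k k) h0
  have l2 : Tendsto (fun n => h1Seminorm Ω (fderiv ℝ (φ n))) atTop (𝓝 (h1Seminorm Ω G)) := by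
    unfold h1Seminorm
    refine Tendsto.sqrt (tendsto_finsetSum _ fun k _ => tendsto_finsetSum _ fun j _ => ?_)
    simp only [sq]
    exact tendsto_integral_mul (fun n => memLp_entry (hm n) j k) (fun n => memLp_entry (hm n) j k)
      (memLp_entry h.memLp_jacobian j k) (memLp_entry h.memLp_jacobian j k) (he j k) (he j k)
  exact le_of_tendsto_of_tendsto' l1 (l2.const_mul T) fun n => hT _ (hφ n)

end

/-! ### Mollification. -/

section

variable {d : ℕ} {V : Type*} [NormedAddCommGroup V] [NormedSpace ℝ V]

/-- The mollification of `v` by a bump function. -/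
def moll (ρ : ContDiffBump (0 : Space d)) (v : Space d → V) : Space d → V :=
  convolution (ρ.normed volume) v (ContinuousLinearMap.lsmul ℝ ℝ) volume

theorem moll_apply (ρ : ContDiffBump (0 : Space d)) (v : Space d → V) (x : Space d) :
    moll ρ v x = ∫ t, ρ.normed volume (x - t) • v t := by
  simp [moll, convolution_eq_swap]

theorem contDiff_moll [CompleteSpace V] (ρ : ContDiffBump (0 : Space d)) {v : Space d → V}
    (hv : LocallyIntegrable v) : ContDiff ℝ ∞ (moll ρ v) :=
  ρ.hasCompactSupport_normed.contDiff_convolution_left _ ρ.contDiff_normed hv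

theorem moll_eq_zero [CompleteSpace V] (ρ : ContDiffBump (0 : Space d)) {v : Space d → V}
    {x : Space d} (h : ∀ t ∈ ball x ρ.rOut, v t = 0) : moll ρ v x = 0 := by
  have h0 := h x (mem_ball_self ρ.rOut_pos)
  rw [moll, ρ.normed_convolution_eq_right (fun t ht => (h t ht).trans h0.symm), h0]

/-- The kernel is a probability density, so an almost everywhere bound becomes a bound at every
point. -/
theorem norm_moll_le (ρ : ContDiffBump (0 : Space d)) {v : Space d → V} {M : ℝ}
    (h : ∀ᵐ x, ‖v x‖ ≤ M) (x : Space d) : ‖moll ρ v x‖ ≤ M := by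
  have hi : Integrable (fun t => ρ.normed volume (x - t)) :=
    (ρ.integrable_normed (μ := volume)).comp_sub_left x
  have h1 : ∫ t, ρ.normed volume (x - t) = 1 := by
    rw [integral_sub_left_eq_self (fun t => ρ.normed volume t) volume x, ρ.integral_normed]
  rw [moll_apply]
  calc _ ≤ ∫ t, ρ.normed volume (x - t) * M := by
        refine norm_integral_le_of_norm_le (hi.mul_const M) ?_
        filter_upwards [h] with t ht
        rw [norm_smul, Real.norm_of_nonneg (ρ.nonneg_normed _)]
        exact mul_le_mul_of_nonneg_left ht (ρ.nonneg_normed _)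
    _ = M := by rw [integral_mul_const, h1, one_mul]

theorem clm_ext_entries {A B : Space d →L[ℝ] Space d}
    (h : ∀ i j : Fin d, A (basisVec j) i = B (basisVec j) i) : A = B := by
  ext1 x
  have hx : x = ∑ j, x j • basisVec j := by
    ext i
    simp [Finset.sum_apply, Pi.single_apply]
  rw [hx, map_sum, map_sum]
  refine Finset.sum_congr rfl fun j _ => ?_
  rw [map_smul, map_smul]
  congr 1
  ext i
  exact h i j

/-- The mollification of a weakly differentiable field is differentiated under the convolution. -/
theorem fderiv_moll {U : Set (Space d)} {v : Space d → Space d}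
    {G : Space d → Space d →L[ℝ] Space d} (h : IsWeakJacobian U v G) (hv : LocallyIntegrable v)
    (hG : LocallyIntegrable G) (ρ : ContDiffBump (0 : Space d)) {x : Space d}
    (hx : closedBall x ρ.rOut ⊆ U) : fderiv ℝ (moll ρ v) x = moll ρ G x := by
  set f := ρ.normed volume with hf
  have hfc : HasCompactSupport f := ρ.hasCompactSupport_normed
  have hfs : ContDiff ℝ ∞ f := ρ.contDiff_normed
  -- The reflected and translated kernel is the test function. Its derivative in `t` carries a minus
  -- sign, which cancels the one in the definition of the weak Jacobian.
  let φ : Space d → ℝ := fun t => f (x - t)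
  have hsupp : Function.support φ ⊆ closedBall x ρ.rOut := by
    intro t ht
    have : x - t ∈ Function.support f := ht
    rw [hf, ρ.support_normed_eq, mem_ball_zero_iff, ← dist_eq_norm] at this
    rw [mem_closedBall, dist_comm]; exact this.le
  have hts : tsupport φ ⊆ closedBall x ρ.rOut := closure_minimal hsupp isClosed_closedBall
  have hφ : IsTestFunction U φ :=
    { contDiff := hfs.comp (contDiff_const.sub contDiff_id)
      hasCompactSupport := HasCompactSupport.intro (isCompact_closedBall x ρ.rOut)
        fun t ht => by_contra fun h0 => ht (hsupp h0)
      tsupport_subset := hts.trans hx }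
  have hφ' : ∀ t w, fderiv ℝ φ t w = - fderiv ℝ f (x - t) w := by
    intro t w
    have h1 : HasFDerivAt φ ((fderiv ℝ f (x - t)).comp (-ContinuousLinearMap.id ℝ (Space d))) t :=
      ((hfs.differentiable (by simp)) (x - t)).hasFDerivAt.comp t
        ((hasFDerivAt_id t).const_sub x)
    rw [h1.fderiv]; simp
  have hder : HasFDerivAt (moll ρ v) _ x :=
    hfc.hasFDerivAt_convolution_left (ContinuousLinearMap.lsmul ℝ ℝ) (hfs.of_le (by simp)) hv x
  rw [hder.fderiv]
  refine clm_ext_entries fun i j => ?_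
  let e : (Space d →L[ℝ] Space d) →L[ℝ] ℝ := (EuclideanSpace.proj i : Space d →L[ℝ] ℝ).comp
      (ContinuousLinearMap.apply ℝ (Space d) (basisVec j))
  have hl := ((hfc.fderiv ℝ).convolutionExists_left
    ((ContinuousLinearMap.lsmul ℝ ℝ (E := Space d)).precompL (Space d))
    (hfs.continuous_fderiv (by simp)) hv x).integrable_swap
  have hr := (hfc.convolutionExists_left (ContinuousLinearMap.lsmul ℝ ℝ) hfs.continuous
    hG x).integrable_swap
  have el := e.integral_comp_comm hl
  have er := e.integral_comp_comm hr
  rw [← convolution_eq_swap] at el er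
  change e _ = e _
  refine el.symm.trans (Eq.trans ?_ er)
  have hout : ∀ t, t ∉ U → φ t = 0 := fun t ht =>
    image_eq_zero_of_notMem_tsupport fun h' => ht (hx (hts h'))
  have hout' : ∀ t, t ∉ U → fderiv ℝ φ t = 0 := fun t ht =>
    image_eq_zero_of_notMem_tsupport fun h' => ht (hx (hts (tsupport_fderiv_subset ℝ h')))
  have key := h.integral_eq φ hφ i j
  rw [setIntegral_eq_integral_of_forall_compl_eq_zero (fun t ht => by simp [hout' t ht]),
    setIntegral_eq_integral_of_forall_compl_eq_zero (fun t ht => by simp [hout t ht])] at key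
  simp only [hφ', mul_neg, integral_neg, neg_inj] at key
  have e1 : ∀ t, e (((ContinuousLinearMap.lsmul ℝ ℝ (E := Space d)).precompL (Space d))
      (fderiv ℝ f (x - t)) (v t)) = v t i * fderiv ℝ f (x - t) (basisVec j) := fun t => by
    simp [e, mul_comm]
  have e2 : ∀ t, e ((ContinuousLinearMap.lsmul ℝ ℝ) (f (x - t)) (G t)) =
      G t (basisVec j) i * φ t := fun t => by
    simp [e, φ, mul_comm]
  simp only [e1, e2]
  exact key

theorem memLp_of_bounded {K : Set (Space d)} {W : Type*} [NormedAddCommGroup W]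
    (hK : IsCompact K) {w : Space d → W} {M : ℝ} (hm : AEStronglyMeasurable w volume) (h0 : ∀ x, x ∉ K → w x = 0) (hM : ∀ᵐ x, ‖w x‖ ≤ M)
    (p : ℝ≥0∞) : MemLp w p volume := by
  have hw : K.indicator w = w := by
    ext x
    by_cases hx : x ∈ K
    · simp [hx]
    · simp [hx, h0 x hx]
  rw [← hw, memLp_indicator_iff_restrict hK.measurableSet]
  have : IsFiniteMeasure (volume.restrict K) := ⟨by simpa using hK.measure_lt_top⟩
  exact MemLp.of_bound hm.restrict M (ae_restrict_of_ae hM)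

/-- Bump functions with outer radius tending to zero and at most `δ`. -/
def bumpSeq {δ : ℝ} (hδ : 0 < δ) (k : ℕ) : ContDiffBump (0 : Space d) where
  rIn := δ / (2 * (k + 1))
  rOut := δ / (k + 1)
  rIn_pos := by positivity
  rIn_lt_rOut := by
    gcongr
    have : (0 : ℝ) < k + 1 := by positivity
    linarith

theorem tendsto_rOut_bumpSeq {δ : ℝ} (hδ : 0 < δ) :
    Tendsto (fun k => (bumpSeq (d := d) hδ k).rOut) atTop (𝓝 0) := by
  have := tendsto_one_div_add_atTop_nhds_zero_nat (𝕜 := ℝ).const_mul δ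
  simpa [bumpSeq, div_eq_mul_inv] using this

theorem rOut_bumpSeq_le {δ : ℝ} (hδ : 0 < δ) (k : ℕ) : (bumpSeq (d := d) hδ k).rOut ≤ δ :=
  div_le_self hδ.le (by simp)

/-- Lebesgue differentiation requires a bounded ratio of outer to inner radius; for `bumpSeq` it is
exactly `2`. -/
theorem ae_tendsto_moll [CompleteSpace V] {δ : ℝ} (hδ : 0 < δ) {w : Space d → V}
    (hw : LocallyIntegrable w) :
    ∀ᵐ x, Tendsto (fun k => moll (bumpSeq hδ k) w x) atTop (𝓝 (w x)) := by
  refine ContDiffBump.ae_convolution_tendsto_right_of_locallyIntegrable (K := 2)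
    (tendsto_rOut_bumpSeq hδ) (Eventually.of_forall fun k => ?_) hw
  simp only [bumpSeq]
  apply le_of_eq
  field_simp

/-- Dominated convergence in `L²`, for uniformly bounded functions supported in a compact set. -/
theorem tendsto_eLpNorm_of_bounded {W : Type*} [NormedAddCommGroup W] {K : Set (Space d)}
    (hK : IsCompact K) {w : ℕ → Space d → W} {M : ℝ} (hm : ∀ n, AEStronglyMeasurable (w n) volume) (h0 : ∀ n x, x ∉ K → w n x = 0)
    (hM : ∀ n, ∀ᵐ x, ‖w n x‖ ≤ M) (hl : ∀ᵐ x, Tendsto (fun n => w n x) atTop (𝓝 0)) :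
    Tendsto (fun n => eLpNorm (w n) 2 volume) atTop (𝓝 0) := by
  simp_rw [eLpNorm_eq_lintegral_rpow_enorm_toReal (p := 2) (by simp) (by simp)]
  have key : Tendsto (fun n => ∫⁻ x, ‖w n x‖ₑ ^ (2 : ℝ≥0∞).toReal) atTop (𝓝 (∫⁻ _ : Space d, 0)) := by
    refine tendsto_lintegral_of_dominated_convergence'
      (K.indicator fun _ => ENNReal.ofReal M ^ (2 : ℝ)) (fun n => (hm n).enorm.pow_const _)
      (fun n => ?_) ?_ ?_
    · filter_upwards [hM n] with x hx
      by_cases hxK : x ∈ K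
      · rw [Set.indicator_of_mem hxK]
        simp only [ENNReal.toReal_ofNat]
        gcongr
        rw [← ofReal_norm]
        exact ENNReal.ofReal_le_ofReal hx
      · simp [h0 n x hxK]
    · rw [lintegral_indicator hK.measurableSet, setLIntegral_const]
      exact ENNReal.mul_ne_top (by simp) hK.measure_lt_top.ne
    · filter_upwards [hl] with x hx
      have h1 : Tendsto (fun n => ‖w n x‖ₑ) atTop (𝓝 0) := by
        simpa [Function.comp_def] using (continuous_enorm.tendsto (0 : W)).comp hx
      have h2 := (ENNReal.continuous_rpow_const (y := (2 : ℝ≥0∞).toReal)).tendsto 0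
      simpa [Function.comp_def] using h2.comp h1
  have h2 := (ENNReal.continuous_rpow_const (y := 1 / (2 : ℝ≥0∞).toReal)).tendsto 0
  rw [lintegral_zero] at key
  simpa [Function.comp_def] using h2.comp key

/-! ### Compactly supported fields in `H^1_0`, and extension by zero. -/

/-- Bounded weakly differentiable fields with compact support are in `H^1_0`. -/
theorem isH10_of_compact_support {U K : Set (Space d)} (hU : IsOpen U) (hK : IsCompact K)
    (hKU : K ⊆ U) {v : Space d → Space d} {G : Space d → Space d →L[ℝ] Space d}
    (h : IsWeakJacobian U v G) {M : ℝ} (hvm : AEStronglyMeasurable v volume)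
    (hGm : AEStronglyMeasurable G volume) (hv0 : ∀ x, x ∉ K → v x = 0) (hG0 : ∀ x, x ∉ K → G x = 0)
    (hvM : ∀ᵐ x, ‖v x‖ ≤ M) (hGM : ∀ᵐ x, ‖G x‖ ≤ M) : IsH10 U v G := by
  have hvi : LocallyIntegrable v volume :=
    (memLp_one_iff_integrable.1 (memLp_of_bounded hK hvm hv0 hvM 1)).locallyIntegrable
  have hGi : LocallyIntegrable G volume :=
    (memLp_one_iff_integrable.1 (memLp_of_bounded hK hGm hG0 hGM 1)).locallyIntegrable
  obtain ⟨δ₂, hδ₂, hδU⟩ := hK.exists_cthickening_subset_open hU hKU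
  -- One `δ` contains the supports of the mollifications; the second keeps kernels centred in the
  -- `δ`-thickening inside `U`.
  obtain ⟨δ, hδ, rfl⟩ : ∃ δ, 0 < δ ∧ δ₂ = δ + δ := ⟨δ₂ / 2, by positivity, by ring⟩
  set ρ : ℕ → ContDiffBump (0 : Space d) := bumpSeq hδ with hρ
  have hr : ∀ k, (ρ k).rOut ≤ δ := rOut_bumpSeq_le hδ
  have hKδ : IsCompact (cthickening δ K) := hK.cthickening
  have hsub : cthickening δ K ⊆ U := (cthickening_mono (by linarith) K).trans hδU
  have hKs : K ⊆ cthickening δ K := self_subset_cthickening K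
  have hzero : ∀ {W : Type} [NormedAddCommGroup W] [NormedSpace ℝ W] [CompleteSpace W]
      (w : Space d → W), (∀ x, x ∉ K → w x = 0) → ∀ k x, x ∉ cthickening δ K →
        moll (ρ k) w x = 0 := by
    intro W _ _ _ w hw k x hx
    refine moll_eq_zero _ fun t ht => hw t fun htK => hx ?_
    refine mem_cthickening_of_dist_le x t δ K htK ?_
    rw [dist_comm]; exact (mem_ball.1 ht).le.trans (hr k)
  have hts : ∀ k, tsupport (moll (ρ k) v) ⊆ cthickening δ K := fun k =>
    closure_minimal (fun x hx => by_contra fun hn => hx (hzero v hv0 k x hn)) isClosed_cthickening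
  have hfd : ∀ k, fderiv ℝ (moll (ρ k) v) = moll (ρ k) G := by
    intro k
    ext1 x
    by_cases hx : x ∈ cthickening δ K
    · refine fderiv_moll h hvi hGi _ ((closedBall_subset_closedBall (hr k)).trans ?_)
      exact (closedBall_subset_cthickening hx δ).trans
        ((cthickening_cthickening_subset hδ.le hδ.le K).trans hδU)
    · rw [hzero G hG0 k x hx]
      exact image_eq_zero_of_notMem_tsupport fun h' => hx (hts k (tsupport_fderiv_subset ℝ h'))
  have hconv : ∀ {W : Type} [NormedAddCommGroup W] [NormedSpace ℝ W] [CompleteSpace W]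
      (w : Space d → W), LocallyIntegrable w volume → (∀ x, x ∉ K → w x = 0) →
      (∀ᵐ x, ‖w x‖ ≤ M) →
      Tendsto (fun k => eLpNorm (moll (ρ k) w - w) 2 (volume.restrict U)) atTop (𝓝 0) := by
    intro W _ _ _ w hwi hw0 hwM
    have h1 : Tendsto (fun k => eLpNorm (moll (ρ k) w - w) 2 volume) atTop (𝓝 0) := by
      refine tendsto_eLpNorm_of_bounded hKδ (M := M + M) (fun k => ?_) (fun k x hx => ?_)
        (fun k => ?_) ?_
      · exact (contDiff_moll _ hwi).continuous.aestronglyMeasurable.sub hwi.aestronglyMeasurable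
      · simp [hzero w hw0 k x hx, hw0 x fun h' => hx (hKs h')]
      · filter_upwards [hwM] with x hx
        exact (norm_sub_le _ _).trans (add_le_add (norm_moll_le _ hwM x) hx)
      · filter_upwards [ae_tendsto_moll hδ hwi] with x hx
        simpa using hx.sub_const (w x)
    exact tendsto_of_tendsto_of_tendsto_of_le_of_le tendsto_const_nhds h1 (fun _ => zero_le)
      fun k => eLpNorm_mono_measure _ Measure.restrict_le_self
  refine ⟨h, (memLp_of_bounded hK hvm hv0 hvM 2).restrict _,
    (memLp_of_bounded hK hGm hG0 hGM 2).restrict _, fun k => moll (ρ k) v, fun k => ?_,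
    hconv v hvi hv0 hvM, ?_⟩
  · exact ⟨contDiff_moll _ hvi, HasCompactSupport.intro hKδ fun x hx => hzero v hv0 k x hx,
      (hts k).trans hsub⟩
  · simp_rw [hfd]
    exact hconv G hGi hG0 hGM

/-- The field and the Jacobian of an element of `W^{1,∞}`, extended by zero, are locally
integrable on the whole space. -/
theorem locallyIntegrable_indicator {W : Type*} [NormedAddCommGroup W] {U : Set (Space d)}
    (hU : IsOpen U) {w : Space d → W} (h : MemLp w ∞ (volume.restrict U)) :
    LocallyIntegrable (U.indicator w) volume :=
  ((memLp_indicator_iff_restrict hU.measurableSet).2 h).locallyIntegrable le_top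

theorem locallyIntegrableOn_congr {W : Type*} [NormedAddCommGroup W] {U : Set (Space d)}
    (hU : IsOpen U) {f g : Space d → W} (h : LocallyIntegrableOn f U) (hfg : Set.EqOn f g U) :
    LocallyIntegrableOn g U := by
  intro x hx
  obtain ⟨s, hs, hi⟩ := h x hx
  refine ⟨s ∩ U, inter_mem hs self_mem_nhdsWithin,
    (IntegrableOn.mono_set hi Set.inter_subset_left).congr ?_⟩
  have h1 : ∀ᵐ y ∂volume.restrict U, f y = g y :=
    (ae_restrict_mem hU.measurableSet).mono fun y hy => hfg hy
  exact ae_mono (Measure.restrict_mono Set.inter_subset_right le_rfl) h1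

theorem IsWeakJacobian.congr {U : Set (Space d)} (hU : IsOpen U) {v v' : Space d → Space d}
    {G G' : Space d → Space d →L[ℝ] Space d} (h : IsWeakJacobian U v G) (hv : Set.EqOn v v' U)
    (hG : Set.EqOn G G' U) : IsWeakJacobian U v' G' where
  locallyIntegrableOn := locallyIntegrableOn_congr hU h.locallyIntegrableOn hv
  locallyIntegrableOn_jacobian := locallyIntegrableOn_congr hU h.locallyIntegrableOn_jacobian hG
  integral_eq := fun φ hφ i j => by
    have h1 := h.integral_eq φ hφ i j
    rw [setIntegral_congr_fun (f := fun x => v x i * fderiv ℝ φ x (basisVec j))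
        (g := fun x => v' x i * fderiv ℝ φ x (basisVec j)) hU.measurableSet
        fun x hx => by simp only [hv hx],
      setIntegral_congr_fun (f := fun x => G x (basisVec j) i * φ x)
        (g := fun x => G' x (basisVec j) i * φ x) hU.measurableSet
        fun x hx => by simp only [hG hx]] at h1
    exact h1

/-- Extension by zero makes convolution on the whole space available. Differentiability is still
claimed only on `U`, so no boundary term arises. -/
theorem IsWeakJacobian.indicator {U : Set (Space d)} (hU : IsOpen U) {v : Space d → Space d}
    {G : Space d → Space d →L[ℝ] Space d} (h : IsWeakJacobian U v G) :
    IsWeakJacobian U (U.indicator v) (U.indicator G) :=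
  h.congr hU (fun _ hx => (Set.indicator_of_mem hx _).symm)
    fun _ hx => (Set.indicator_of_mem hx _).symm

end

/-! ### Continuous `W^{1,∞}` maps: Lipschitz bounds and the chain rule. -/

section

variable {d : ℕ}

/-- A continuous field with weak Jacobian bounded by `L` is locally `L`-Lipschitz. -/
theorem IsW1Infty.lipschitzOnWith_ball {U : Set (Space d)} (hU : IsOpen U) {F : Space d → Space d}
    {DF : Space d → Space d →L[ℝ] Space d} (h : IsW1Infty U F DF) (hF : ContinuousOn F U) {L : ℝ≥0}
    (hL : ∀ᵐ x ∂volume.restrict U, ‖DF x‖ ≤ L) {x₀ : Space d} {r : ℝ} (hr : 0 < r)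
    (hball : closedBall x₀ (r + r) ⊆ U) : LipschitzOnWith L F (ball x₀ r) := by
  have hvi := locallyIntegrable_indicator hU h.memLp
  have hGi := locallyIntegrable_indicator hU h.memLp_jacobian
  have hw := h.isWeakJacobian.indicator hU
  have hGL : ∀ᵐ x, ‖U.indicator DF x‖ ≤ L := by
    filter_upwards [(ae_restrict_iff' hU.measurableSet).1 hL] with x hx
    by_cases hxU : x ∈ U
    · simpa [hxU] using hx hxU
    · simp [hxU]
  -- Kernels of radius at most `r` centred in `ball x₀ r` stay inside `U`, so the mean value
  -- inequality applies on this convex ball.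
  have hlip : ∀ k, LipschitzOnWith L (moll (bumpSeq hr k) (U.indicator F)) (ball x₀ r) := by
    intro k
    refine (convex_ball x₀ r).lipschitzOnWith_of_nnnorm_fderiv_le (𝕜 := ℝ)
      (fun x _ => ((contDiff_moll _ hvi).differentiable (by simp)) x) fun x hx => ?_
    rw [fderiv_moll hw hvi hGi]
    · exact norm_moll_le _ hGL x
    · refine (closedBall_subset_closedBall' ?_).trans hball
      have := rOut_bumpSeq_le (d := d) hr k
      have := (mem_ball.1 hx).le
      linarith
  -- Continuity of `F` gives convergence at every point of the ball, not only almost everywhere, so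
  -- the Lipschitz bound passes to `F` itself.
  have hlim : ∀ x ∈ ball x₀ r,
      Tendsto (fun k => moll (bumpSeq hr k) (U.indicator F) x) atTop (𝓝 (F x)) := by
    intro x hx
    have hxU : x ∈ U := hball (closedBall_subset_closedBall (by linarith) (ball_subset_closedBall hx))
    refine ContDiffBump.convolution_tendsto_right (tendsto_rOut_bumpSeq hr)
      (Eventually.of_forall fun _ => hvi.aestronglyMeasurable) ?_ tendsto_const_nhds
    have hc : ContinuousAt (U.indicator F) x :=
      (hF.continuousAt (hU.mem_nhds hxU)).congr
        ((hU.mem_nhds hxU |> eventually_of_mem) fun y hy => (Set.indicator_of_mem hy _).symm)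
    have := hc.tendsto.comp (tendsto_snd (f := (atTop : Filter ℕ)) (g := 𝓝 x))
    rw [Set.indicator_of_mem hxU] at this
    exact this
  refine LipschitzOnWith.of_dist_le_mul fun x hx y hy => ?_
  exact le_of_tendsto' ((hlim x hx).dist (hlim y hy)) fun k => (hlip k).dist_le_mul x hx y hy

theorem aestronglyMeasurable_comp_jacobian {U : Set (Space d)} (hU : IsOpen U)
    {F : Space d → Space d} {DF : Space d → Space d →L[ℝ] Space d} (hF : ContinuousOn F U)
    (hDF : AEStronglyMeasurable DF (volume.restrict U)) {φ : Space d → Space d}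
    (hφ : ContDiff ℝ ∞ φ) :
    AEStronglyMeasurable (fun x => fderiv ℝ φ (F x) ∘L DF x) (volume.restrict U) :=
  (isBoundedBilinearMap_comp (𝕜 := ℝ) (E := Space d) (F := Space d)
    (G := Space d)).continuous.comp_aestronglyMeasurable
    ((((hφ.continuous_fderiv (by simp)).comp_continuousOn hF).aestronglyMeasurable
      hU.measurableSet).prodMk hDF)

/-- The chain rule for the composition of a smooth field with a continuous `W^{1,∞}` map. -/
theorem IsW1Infty.isWeakJacobian_comp {U : Set (Space d)} (hU : IsOpen U) {F : Space d → Space d}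
    {DF : Space d → Space d →L[ℝ] Space d} (h : IsW1Infty U F DF) (hF : ContinuousOn F U) {L : ℝ}
    (hL : ∀ᵐ x ∂volume.restrict U, ‖DF x‖ ≤ L) {φ : Space d → Space d}
    (hφ : ContDiff ℝ ∞ φ) (hφc : HasCompactSupport φ) :
    IsWeakJacobian U (fun x => φ (F x)) (fun x => fderiv ℝ φ (F x) ∘L DF x) := by
  have hdφ : Continuous (fderiv ℝ φ) := hφ.continuous_fderiv (by simp)
  obtain ⟨C₀, hC₀⟩ := hφ.continuous.bounded_above_of_compact_support hφc
  obtain ⟨C, hC⟩ := hdφ.bounded_above_of_compact_support (hφc.fderiv ℝ)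
  have hCn : 0 ≤ C := (norm_nonneg _).trans (hC 0)
  have hJm := aestronglyMeasurable_comp_jacobian hU hF h.memLp_jacobian.aestronglyMeasurable hφ
  have hJ : MemLp (fun x => fderiv ℝ φ (F x) ∘L DF x) ∞ (volume.restrict U) := by
    refine memLp_top_of_bound hJm (C * L) ?_
    filter_upwards [hL] with x hx
    exact (ContinuousLinearMap.opNorm_comp_le _ _).trans
      (mul_le_mul (hC _) hx (norm_nonneg _) hCn)
  refine ⟨(hφ.continuous.comp_continuousOn hF).locallyIntegrableOn hU.measurableSet,
    locallyIntegrableOn_congr hU ((locallyIntegrable_indicator hU hJ).locallyIntegrableOn U)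
      (fun x hx => Set.indicator_of_mem hx _), fun ψ hψ i j => ?_⟩
  have hvi := locallyIntegrable_indicator hU h.memLp
  have hGi := locallyIntegrable_indicator hU h.memLp_jacobian
  have hw := h.isWeakJacobian.indicator hU
  -- The real number `L` has no assumed sign, while the zero extension needs a nonnegative bound.
  have hGL : ∀ᵐ x, ‖U.indicator DF x‖ ≤ max L 0 := by
    filter_upwards [(ae_restrict_iff' hU.measurableSet).1 hL] with x hx
    by_cases hxU : x ∈ U
    · simpa [hxU] using Or.inl (hx hxU)
    · simp [hxU]
  obtain ⟨δ, hδ, hδU⟩ := hψ.hasCompactSupport.isCompact.exists_cthickening_subset_open hU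
    hψ.tsupport_subset
  set f : ℕ → Space d → Space d := fun k => moll (bumpSeq hδ k) (U.indicator F) with hf
  have hfs : ∀ k, ContDiff ℝ ∞ (f k) := fun k => contDiff_moll _ hvi
  have hψd : Continuous (fderiv ℝ ψ) := hψ.contDiff.continuous_fderiv (by simp)
  have hψd' : Continuous fun x => fderiv ℝ ψ x (basisVec j) := hψd.clm_apply continuous_const
  have hψdc : HasCompactSupport fun x => fderiv ℝ ψ x (basisVec j) :=
    (hψ.hasCompactSupport.fderiv ℝ).comp_left (g := fun A : Space d →L[ℝ] ℝ => A (basisVec j)) rfl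
  have hψ0 : ∀ x, x ∉ U → ψ x = 0 := fun x hx =>
    image_eq_zero_of_notMem_tsupport fun h' => hx (hψ.tsupport_subset h')
  have hψd0 : ∀ x, x ∉ U → fderiv ℝ ψ x = 0 := fun x hx =>
    image_eq_zero_of_notMem_tsupport fun h' =>
      hx (hψ.tsupport_subset (tsupport_fderiv_subset ℝ h'))
  have coord : ∀ (y : Space d), |y i| ≤ ‖y‖ := fun y => by
    simpa using PiLp.norm_apply_le y i
  -- Mollifying `F` makes the composition smooth. On the support of `ψ` the derivative of `f k` is
  -- the mollification of `DF`, so ordinary integration by parts applies, and dominated convergence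
  -- then passes to the limit.
  have hparts : ∀ k, ∫ x, φ (f k x) i * fderiv ℝ ψ x (basisVec j) =
      - ∫ x, (fderiv ℝ φ (f k x) (moll (bumpSeq hδ k) (U.indicator DF) x (basisVec j))) i * ψ x := by
    intro k
    let u : Space d → ℝ := fun x => φ (f k x) i
    have hu : ContDiff ℝ ∞ u :=
      (EuclideanSpace.proj i : Space d →L[ℝ] ℝ).contDiff.comp (hφ.comp (hfs k))
    have hud : ∀ x, fderiv ℝ u x (basisVec j) =
        (fderiv ℝ φ (f k x) (fderiv ℝ (f k) x (basisVec j))) i := by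
      intro x
      have h1 : HasFDerivAt u ((EuclideanSpace.proj i : Space d →L[ℝ] ℝ).comp
          ((fderiv ℝ φ (f k x)).comp (fderiv ℝ (f k) x))) x :=
        (EuclideanSpace.proj i : Space d →L[ℝ] ℝ).hasFDerivAt.comp x
          (((hφ.differentiable (by simp)) _).hasFDerivAt.comp x
            (((hfs k).differentiable (by simp)) x).hasFDerivAt)
      rw [h1.fderiv]; simp
    have hdu : Continuous fun x => fderiv ℝ u x (basisVec j) :=
      (hu.continuous_fderiv (by simp)).clm_apply continuous_const
    have := integral_mul_fderiv_eq_neg_fderiv_mul_of_integrable (μ := volume) (f := u) (g := ψ)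
      (v := basisVec j)
      ((hdu.mul hψ.contDiff.continuous).integrable_of_hasCompactSupport
        hψ.hasCompactSupport.mul_left)
      ((hu.continuous.mul hψd').integrable_of_hasCompactSupport hψdc.mul_left)
      ((hu.continuous.mul hψ.contDiff.continuous).integrable_of_hasCompactSupport
        hψ.hasCompactSupport.mul_left)
      (fun x _ => (hu.differentiable (by simp)) x)
      (fun x _ => (hψ.contDiff.differentiable (by simp)) x)
    refine this.trans (congrArg Neg.neg (integral_congr_ae (Eventually.of_forall fun x => ?_)))
    by_cases hx : x ∈ tsupport ψ
    · simp only [hud]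
      rw [fderiv_moll hw hvi hGi]
      exact (closedBall_subset_closedBall (rOut_bumpSeq_le hδ k)).trans
        ((closedBall_subset_cthickening hx δ).trans hδU)
    · simp [image_eq_zero_of_notMem_tsupport hx]
  have hFae := ae_tendsto_moll hδ hvi
  have hGae := ae_tendsto_moll hδ hGi
  have hGc : ∀ k, Continuous (moll (bumpSeq hδ k) (U.indicator DF)) := fun k =>
    (contDiff_moll _ hGi).continuous
  have proj_c : Continuous fun y : Space d => y i :=
    (EuclideanSpace.proj i : Space d →L[ℝ] ℝ).continuous
  have l1 : Tendsto (fun k => ∫ x, φ (f k x) i * fderiv ℝ ψ x (basisVec j)) atTop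
      (𝓝 (∫ x, φ (U.indicator F x) i * fderiv ℝ ψ x (basisVec j))) := by
    refine tendsto_integral_of_dominated_convergence
      (fun x => C₀ * |fderiv ℝ ψ x (basisVec j)|) (fun k => ?_) ?_ (fun k => ?_) ?_
    · exact ((proj_c.comp (hφ.continuous.comp (hfs k).continuous)).mul hψd').aestronglyMeasurable
    · exact (hψd'.integrable_of_hasCompactSupport hψdc).abs.const_mul _
    · refine Eventually.of_forall fun x => ?_
      rw [Real.norm_eq_abs, abs_mul]
      exact mul_le_mul_of_nonneg_right ((coord _).trans (hC₀ _)) (abs_nonneg _)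
    · filter_upwards [hFae] with x hx
      exact (((proj_c.comp hφ.continuous).tendsto _).comp hx).mul_const _
  have l2 : Tendsto (fun k => ∫ x, (fderiv ℝ φ (f k x)
        (moll (bumpSeq hδ k) (U.indicator DF) x (basisVec j))) i * ψ x) atTop
      (𝓝 (∫ x, (fderiv ℝ φ (U.indicator F x) (U.indicator DF x (basisVec j))) i * ψ x)) := by
    refine tendsto_integral_of_dominated_convergence
      (fun x => C * max L 0 * |ψ x|) (fun k => ?_) ?_ (fun k => ?_) ?_
    · exact ((proj_c.comp ((hdφ.comp (hfs k).continuous).clm_apply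
        ((hGc k).clm_apply continuous_const))).mul hψ.contDiff.continuous).aestronglyMeasurable
    · exact (hψ.contDiff.continuous.integrable_of_hasCompactSupport
        hψ.hasCompactSupport).abs.const_mul _
    · refine Eventually.of_forall fun x => ?_
      rw [Real.norm_eq_abs, abs_mul]
      refine mul_le_mul_of_nonneg_right ((coord _).trans ?_) (abs_nonneg _)
      refine (ContinuousLinearMap.le_opNorm _ _).trans (mul_le_mul (hC _) ?_ (norm_nonneg _) hCn)
      refine (ContinuousLinearMap.le_opNorm _ _).trans ?_
      simpa using norm_moll_le (bumpSeq hδ k) hGL x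
    · filter_upwards [hFae, hGae] with x hx hx'
      have hc : Continuous fun p : (Space d →L[ℝ] Space d) × (Space d →L[ℝ] Space d) =>
        (p.1 (p.2 (basisVec j))) i := by fun_prop
      exact ((hc.tendsto (_, _)).comp
        (((hdφ.tendsto _).comp hx).prodMk_nhds hx')).mul_const _
  have e := tendsto_nhds_unique (l1.congr hparts) l2.neg
  have s1 : ∫ x in U, φ (F x) i * fderiv ℝ ψ x (basisVec j) =
      ∫ x, φ (U.indicator F x) i * fderiv ℝ ψ x (basisVec j) := by
    refine Eq.trans ?_ (setIntegral_eq_integral_of_forall_compl_eq_zero (s := U)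
      (fun t ht => by simp [hψd0 t ht]))
    exact setIntegral_congr_fun hU.measurableSet fun x hx => by simp [hx]
  have s2 : ∫ x in U, (fderiv ℝ φ (F x) ∘L DF x) (basisVec j) i * ψ x =
      ∫ x, (fderiv ℝ φ (U.indicator F x) (U.indicator DF x (basisVec j))) i * ψ x := by
    refine Eq.trans ?_ (setIntegral_eq_integral_of_forall_compl_eq_zero (s := U)
      (fun t ht => by simp [hψ0 t ht]))
    exact setIntegral_congr_fun hU.measurableSet fun x hx => by simp [hx]
  exact s1.trans (e.trans (congrArg Neg.neg s2.symm))

/-! ### Volume distortion and densities. -/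

/-- A map which is `L`-Lipschitz near each point of an open set increases volumes there at most by
the factor `L^d`. -/
theorem volume_image_le {U : Set (Space d)} {F : Space d → Space d} {L : ℝ≥0}
    (h : ∀ x ∈ U, ∃ B, IsOpen B ∧ x ∈ B ∧ LipschitzOnWith L F B) {A : Set (Space d)} (hAU : A ⊆ U)
    (hA : MeasurableSet A) : volume (F '' A) ≤ (L : ℝ≥0∞) ^ d * volume A := by
  -- Lebesgue measure is a multiple of the `d`-dimensional Hausdorff measure, which scales by `L ^
  -- d` under Lipschitz maps; the multiple cancels.
  have hball : ∀ s : Set (Space d), LipschitzOnWith L F s →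
      volume (F '' s) ≤ (L : ℝ≥0∞) ^ d * volume s := by
    intro s hs
    have h1 := hs.hausdorffMeasure_image_le (d := d) d.cast_nonneg
    have h2 : (volume : Measure (Space d)) =
        (volume : Measure (Space d)).addHaarScalarFactor (Measure.hausdorffMeasure d) •
          Measure.hausdorffMeasure d := Measure.isAddLeftInvariant_eq_smul _ _
    rw [h2]
    simp only [Measure.smul_apply, ENNReal.smul_def, smul_eq_mul]
    rw [mul_left_comm]
    refine mul_le_mul_right ?_ _
    simpa using h1
  choose! B hBo hxB hB using h
  -- Lindelöf yields countably many balls of local Lipschitz control; made disjoint, they allow the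
  -- estimates to be summed without overcounting.
  obtain ⟨T, hTU, hTc, hT⟩ := TopologicalSpace.countable_cover_nhdsWithin (f := B) (s := U)
    fun x hx => mem_nhdsWithin_of_mem_nhds ((hBo x hx).mem_nhds (hxB x hx))
  rcases T.eq_empty_or_nonempty with rfl | hTne
  · have : A = ∅ := Set.subset_empty_iff.1 ((hAU.trans hT).trans (by simp))
    simp [this]
  obtain ⟨t, rfl⟩ := hTc.exists_eq_range hTne
  let P : ℕ → Set (Space d) := disjointed fun n => B (t n)
  have hPm : ∀ n, MeasurableSet (P n) := MeasurableSet.disjointed fun n =>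
    (hBo _ (hTU ⟨n, rfl⟩)).measurableSet
  have hPB : ∀ n, P n ⊆ B (t n) := fun n => disjointed_subset _ n
  have hAP : A = ⋃ n, A ∩ P n := by
    rw [← Set.inter_iUnion, iUnion_disjointed, Set.left_eq_inter]
    refine (hAU.trans hT).trans ?_
    simp
  calc volume (F '' A) = volume (⋃ n, F '' (A ∩ P n)) := by rw [← Set.image_iUnion, ← hAP]
    _ ≤ ∑' n, volume (F '' (A ∩ P n)) := measure_iUnion_le _
    _ ≤ ∑' n, (L : ℝ≥0∞) ^ d * volume (A ∩ P n) := ENNReal.tsum_le_tsum fun n =>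
        hball _ ((hB _ (hTU ⟨n, rfl⟩)).mono (Set.inter_subset_right.trans (hPB n)))
    _ = (L : ℝ≥0∞) ^ d * volume A := by
        rw [ENNReal.tsum_mul_left, ← measure_iUnion (fun m n hmn => ?_)
          (fun n => hA.inter (hPm n)), ← hAP]
        exact ((disjoint_disjointed _ hmn).mono Set.inter_subset_right Set.inter_subset_right)

/-- The volume of the source of a homeomorphism with locally `L`-Lipschitz inverse, transported to
the target, has density at most `L^d`. -/
theorem map_volume_le (F : OpenPartialHomeomorph (Space d) (Space d)) {L : ℝ≥0}
    (h : ∀ x ∈ F.target, ∃ B, IsOpen B ∧ x ∈ B ∧ LipschitzOnWith L F.symm B) :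
    (volume.restrict F.source).map F ≤ (L ^ d) • volume.restrict F.target := by
  refine Measure.le_iff.2 fun s hs => ?_
  rw [Measure.map_apply_of_aemeasurable
    (F.continuousOn.aemeasurable F.open_source.measurableSet) hs,
    Measure.restrict_apply' F.open_source.measurableSet, Measure.smul_apply,
    Measure.restrict_apply hs, Set.inter_comm, Set.inter_comm s,
    show F.source ∩ F ⁻¹' s = F.symm '' (F.target ∩ s) from (F.symm.image_source_inter_eq' s).symm]
  simpa [ENNReal.smul_def] using volume_image_le h Set.inter_subset_left
    (F.open_target.measurableSet.inter hs)

/-- The volume of the source of a locally `L`-Lipschitz homeomorphism, transported to the target,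
has density at least `L^{-d}`. -/
theorem volume_le_map (F : OpenPartialHomeomorph (Space d) (Space d)) {L : ℝ≥0}
    (h : ∀ x ∈ F.source, ∃ B, IsOpen B ∧ x ∈ B ∧ LipschitzOnWith L F B) :
    volume.restrict F.target ≤ (L ^ d) • (volume.restrict F.source).map F := by
  refine Measure.le_iff.2 fun s hs => ?_
  have hm : MeasurableSet (F.source ∩ F ⁻¹' s) := by
    have := F.open_source.measurableSet.subtype_image
      (F.continuousOn.domRestrict.measurable hs)
    rwa [← Subtype.image_preimage_coe]
  rw [Measure.smul_apply, Measure.map_apply_of_aemeasurable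
    (F.continuousOn.aemeasurable F.open_source.measurableSet) hs,
    Measure.restrict_apply' F.open_source.measurableSet, Measure.restrict_apply hs,
    Set.inter_comm (F ⁻¹' s), Set.inter_comm s]
  have := volume_image_le h Set.inter_subset_left hm
  rw [F.image_source_inter_eq', F.target_inter_inv_preimage_preimage] at this
  simpa [ENNReal.smul_def] using this

/-- Each comparison of measures, read on every measurable set, is a pointwise bound on the density.
The lower bound is kept in the product form in which it is later multiplied. -/
theorem rnDeriv_bounds {α : Type*} [MeasurableSpace α] {μ ν : Measure α} [IsFiniteMeasure μ]
    [IsFiniteMeasure ν] {c : ℝ≥0} (h1 : μ ≤ c • ν) (h2 : ν ≤ c • μ) :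
    ∀ᵐ x ∂ν, (μ.rnDeriv ν x).toReal ≤ c ∧ 1 ≤ c * (μ.rnDeriv ν x).toReal := by
  have hac : μ ≪ ν := Measure.absolutelyContinuous_of_le_smul h1
  have hu : ∀ᵐ x ∂ν, μ.rnDeriv ν x ≤ c := by
    refine ae_le_of_forall_setLIntegral_le_of_sigmaFinite (Measure.measurable_rnDeriv _ _)
      fun s hs _ => ?_
    rw [Measure.setLIntegral_rnDeriv hac, setLIntegral_const]
    exact h1 s
  have hl : ∀ᵐ x ∂ν, 1 ≤ c * μ.rnDeriv ν x := by
    refine ae_le_of_forall_setLIntegral_le_of_sigmaFinite measurable_const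
      fun s hs _ => ?_
    rw [lintegral_const_mul _ (Measure.measurable_rnDeriv _ _), Measure.setLIntegral_rnDeriv hac,
      setLIntegral_const, one_mul]
    exact h2 s
  filter_upwards [hu, hl] with x hx hx'
  have hfin : μ.rnDeriv ν x ≠ ⊤ := ne_top_of_le_ne_top ENNReal.coe_ne_top hx
  refine ⟨by simpa using ENNReal.toReal_mono ENNReal.coe_ne_top hx, ?_⟩
  simpa using ENNReal.toReal_mono (ENNReal.mul_ne_top ENNReal.coe_ne_top hfin) hx'

end

/-! ### Transport between source and target, and comparison of `beta`. -/

section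

variable {d : ℕ}

/-- A homeomorphism between open sets of finite volume whose first derivatives, and those of its
inverse, are bounded by `L`, and which has Jacobian `DF`. -/
structure IsBiW1Infty (F : OpenPartialHomeomorph (Space d) (Space d))
    (DF DFinv : Space d → Space d →L[ℝ] Space d) (L : ℝ≥0) : Prop where
  volume_source : volume F.source < ⊤
  volume_target : volume F.target < ⊤
  isW1Infty : IsW1Infty F.source F DF
  isW1Infty_symm : IsW1Infty F.target F.symm DFinv
  norm_le : ∀ᵐ x ∂volume.restrict F.source, ‖DF x‖ ≤ L
  norm_symm_le : ∀ᵐ x ∂volume.restrict F.target, ‖DFinv x‖ ≤ L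

namespace IsBiW1Infty

variable {F : OpenPartialHomeomorph (Space d) (Space d)}
  {DF DFinv : Space d → Space d →L[ℝ] Space d} {L : ℝ≥0}

theorem symm (h : IsBiW1Infty F DF DFinv L) : IsBiW1Infty F.symm DFinv DF L :=
  ⟨h.volume_target, h.volume_source, h.isW1Infty_symm, h.isW1Infty, h.norm_symm_le, h.norm_le⟩

theorem exists_lipschitzOnWith (h : IsBiW1Infty F DF DFinv L) :
    ∀ x ∈ F.source, ∃ B, IsOpen B ∧ x ∈ B ∧ LipschitzOnWith L F B := by
  intro x hx
  obtain ⟨r, hr, hb⟩ := nhds_basis_closedBall.mem_iff.1 (F.open_source.mem_nhds hx)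
  refine ⟨ball x (r / 2), isOpen_ball, mem_ball_self (by positivity),
    h.isW1Infty.lipschitzOnWith_ball F.open_source F.continuousOn h.norm_le (by positivity) ?_⟩
  rwa [add_halves]

theorem map_le (h : IsBiW1Infty F DF DFinv L) :
    (volume.restrict F.source).map F ≤ (L ^ d) • volume.restrict F.target :=
  map_volume_le F h.symm.exists_lipschitzOnWith

theorem le_map (h : IsBiW1Infty F DF DFinv L) :
    volume.restrict F.target ≤ (L ^ d) • (volume.restrict F.source).map F :=
  volume_le_map F h.exists_lipschitzOnWith

theorem aemeasurable (F : OpenPartialHomeomorph (Space d) (Space d)) :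
    AEMeasurable F (volume.restrict F.source) :=
  F.continuousOn.aemeasurable F.open_source.measurableSet

/-- Transport of a mean-zero function from the source to the target, dual to the composition of
continuous functions with the homeomorphism. -/
theorem exists_transport (h : IsBiW1Infty F DF DFinv L) {q' : Space d → ℝ}
    (hq' : IsL2MeanZero F.source q') : ∃ q : Space d → ℝ, IsL2MeanZero F.target q ∧
      l2Norm F.source q' ≤ √((L : ℝ) ^ d) * l2Norm F.target q ∧
      ∀ f : Space d → ℝ, Continuous f →
        ∫ y in F.target, f y * q y = ∫ x in F.source, f (F x) * q' x := by
  set ν := volume.restrict F.target with hν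
  set μ := (volume.restrict F.source).map F with hμ
  have : IsFiniteMeasure (volume.restrict F.source) := ⟨by simpa using h.volume_source⟩
  have : IsFiniteMeasure ν := ⟨by simpa [hν] using h.volume_target⟩
  have hac : μ ≪ ν := Measure.absolutelyContinuous_of_le_smul (c := ((L ^ d : ℝ≥0) : ℝ≥0∞)) h.map_le
  set ρ : Space d → ℝ := fun y => (μ.rnDeriv ν y).toReal with hρ
  have hρm : Measurable ρ := (Measure.measurable_rnDeriv μ ν).ennreal_toReal
  have hb : ∀ᵐ y ∂ν, ρ y ≤ (L : ℝ) ^ d ∧ 1 ≤ (L : ℝ) ^ d * ρ y := by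
    simpa using rnDeriv_bounds h.map_le h.le_map
  set p : Space d → ℝ := q' ∘ F.symm with hp
  have hp2 : MemLp p 2 ν := by
    refine MemLp.comp_of_map ?_ (aemeasurable F.symm)
    exact hq'.memLp.of_measure_le_smul (c := ((L ^ d : ℝ≥0) : ℝ≥0∞)) ENNReal.coe_ne_top h.symm.map_le
  have hpμ : AEStronglyMeasurable p μ := hp2.aestronglyMeasurable.mono_ac hac
  have hpF : ∀ᵐ x ∂volume.restrict F.source, p (F x) = q' x := by
    filter_upwards [ae_restrict_mem F.open_source.measurableSet] with x hx
    simp [hp, F.left_inv hx]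
  have hdual : ∀ f : Space d → ℝ, Continuous f →
      ∫ y in F.target, f y * (ρ y * p y) = ∫ x in F.source, f (F x) * q' x := by
    intro f hf
    calc ∫ y in F.target, f y * (ρ y * p y) = ∫ y, ρ y * (f y * p y) ∂ν := by
          simp only [mul_left_comm, hν]
      _ = ∫ y, f y * p y ∂μ := integral_toReal_rnDeriv_mul hac
      _ = ∫ x in F.source, f (F x) * p (F x) :=
          integral_map (aemeasurable F) (hf.aestronglyMeasurable.mul hpμ)
      _ = _ := integral_congr_ae (hpF.mono fun x hx => by simp only [hx])
  have hq2 : MemLp (fun y => ρ y * p y) 2 ν := by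
    refine hp2.of_le_mul (c := (L : ℝ) ^ d)
      (hρm.aestronglyMeasurable.mul hp2.aestronglyMeasurable) ?_
    filter_upwards [hb] with y hy
    rw [norm_mul, Real.norm_of_nonneg ENNReal.toReal_nonneg]
    exact mul_le_mul_of_nonneg_right hy.1 (norm_nonneg _)
  refine ⟨fun y => ρ y * p y, ⟨hq2, ?_⟩, ?_, hdual⟩
  -- Duality with the constant `1` preserves the mean value.
  · simpa [hq'.integral_eq_zero] using hdual (fun _ => 1) continuous_const
  · rw [l2Norm, l2Norm, ← Real.sqrt_mul (by positivity)]
    refine Real.sqrt_le_sqrt ?_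
    calc ∫ x in F.source, q' x ^ 2 = ∫ x in F.source, p (F x) ^ 2 :=
          integral_congr_ae (hpF.mono fun x hx => by simp only [hx])
      _ = ∫ y, p y ^ 2 ∂μ := (integral_map (f := fun y => p y ^ 2) (aemeasurable F)
          (hpμ.pow 2)).symm
      _ = ∫ y, ρ y * p y ^ 2 ∂ν := (integral_toReal_rnDeriv_mul hac).symm
      -- From `1 ≤ L ^ d * ρ` follows `ρ ≤ L ^ d * ρ ^ 2`: the lower bound on the density controls
      -- the norm of `q'` by that of `q`.
      _ ≤ ∫ y, (L : ℝ) ^ d * (ρ y * p y) ^ 2 ∂ν := by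
          refine integral_mono_of_nonneg
            (Eventually.of_forall fun y => mul_nonneg ENNReal.toReal_nonneg (sq_nonneg _))
            (hq2.integrable_sq.const_mul _) ?_
          filter_upwards [hb] with y hy
          have h0 : 0 ≤ ρ y * p y ^ 2 := mul_nonneg ENNReal.toReal_nonneg (sq_nonneg _)
          calc ρ y * p y ^ 2 ≤ ((L : ℝ) ^ d * ρ y) * (ρ y * p y ^ 2) :=
                le_mul_of_one_le_left h0 hy.2
            _ = (L : ℝ) ^ d * (ρ y * p y) ^ 2 := by ring
      _ = _ := integral_const_mul _ _

/-- The composition of a test function with the homeomorphism belongs to `H^1_0`. -/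
theorem isH10_comp (h : IsBiW1Infty F DF DFinv L) {φ : Space d → Space d}
    (hφ : IsTestFunction F.target φ) :
    IsH10 F.source (F.source.indicator fun x => φ (F x))
      (F.source.indicator fun x => fderiv ℝ φ (F x) ∘L DF x) := by
  have hU := F.open_source
  have hdφ : Continuous (fderiv ℝ φ) := hφ.contDiff.continuous_fderiv (by simp)
  obtain ⟨C₀, hC₀⟩ := hφ.contDiff.continuous.bounded_above_of_compact_support hφ.hasCompactSupport
  obtain ⟨C, hC⟩ := hdφ.bounded_above_of_compact_support (hφ.hasCompactSupport.fderiv ℝ)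
  have hC₀n : 0 ≤ C₀ := (norm_nonneg _).trans (hC₀ 0)
  have hCn : 0 ≤ C := (norm_nonneg _).trans (hC 0)
  -- The support pulls back to a compact subset of the open source, so the behaviour of `F` at the
  -- boundary is irrelevant.
  set K := F.symm '' tsupport φ with hKdef
  have hK : IsCompact K := hφ.hasCompactSupport.isCompact.image_of_continuousOn
    (F.symm.continuousOn.mono hφ.tsupport_subset)
  have hKU : K ⊆ F.source := by
    rintro _ ⟨y, hy, rfl⟩
    exact F.map_target (hφ.tsupport_subset hy)
  have hout : ∀ x ∈ F.source, x ∉ K → F x ∉ tsupport φ := fun x hx hxK hF =>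
    hxK ⟨F x, hF, F.left_inv hx⟩
  refine isH10_of_compact_support hU hK hKU (M := max C₀ (C * L))
    ((h.isW1Infty.isWeakJacobian_comp hU F.continuousOn h.norm_le hφ.contDiff
      hφ.hasCompactSupport).congr hU (Set.eqOn_indicator (f := fun x => φ (F x))).symm
      (Set.eqOn_indicator (f := fun x => fderiv ℝ φ (F x) ∘L DF x)).symm) ?_ ?_ ?_ ?_ ?_ ?_
  · rw [aestronglyMeasurable_indicator_iff hU.measurableSet]
    exact (hφ.contDiff.continuous.comp_continuousOn F.continuousOn).aestronglyMeasurable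
      hU.measurableSet
  · rw [aestronglyMeasurable_indicator_iff hU.measurableSet]
    exact aestronglyMeasurable_comp_jacobian hU F.continuousOn
      h.isW1Infty.memLp_jacobian.aestronglyMeasurable hφ.contDiff
  · intro x hx
    by_cases hxU : x ∈ F.source
    · simp [hxU, image_eq_zero_of_notMem_tsupport (hout x hxU hx)]
    · simp [hxU]
  · intro x hx
    by_cases hxU : x ∈ F.source
    · have : fderiv ℝ φ (F x) = 0 := image_eq_zero_of_notMem_tsupport fun h' =>
        hout x hxU hx (tsupport_fderiv_subset ℝ h')
      simp [hxU, this]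
    · simp [hxU]
  · refine Eventually.of_forall fun x => (norm_indicator_le_norm_self _ _).trans ?_
    exact (hC₀ _).trans (le_max_left _ _)
  · filter_upwards [(ae_restrict_iff' hU.measurableSet).1 h.norm_le] with x hx
    by_cases hxU : x ∈ F.source
    · rw [Set.indicator_of_mem hxU]
      exact ((ContinuousLinearMap.opNorm_comp_le _ _).trans
        (mul_le_mul (hC _) (hx hxU) (norm_nonneg _) hCn)).trans (le_max_right _ _)
    · simp [hxU, hC₀n]

/-- A change of variables in which only the upper bound `L ^ d` on the image measure is needed. -/
theorem integral_frobSq_comp_le (h : IsBiW1Infty F DF DFinv L) {φ : Space d → Space d}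
    (hφ : IsTestFunction F.target φ) : ∫ x in F.source, frobSq (fderiv ℝ φ (F x)) ≤
      (L : ℝ) ^ d * ∫ y in F.target, frobSq (fderiv ℝ φ y) := by
  have hdφ : Continuous (fderiv ℝ φ) := hφ.contDiff.continuous_fderiv (by simp)
  have hm : MemLp (fderiv ℝ φ) 2 (volume.restrict F.target) :=
    (hdφ.memLp_of_hasCompactSupport (hφ.hasCompactSupport.fderiv ℝ)).restrict _
  rw [← integral_map (f := fun y => frobSq (fderiv ℝ φ y)) (aemeasurable F)
    (continuous_frobSq.comp hdφ).aestronglyMeasurable]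
  refine (integral_mono_measure h.map_le (Eventually.of_forall fun y => frobSq_nonneg _)
    ((integrable_frobSq hm).smul_measure_nnreal)).trans_eq ?_
  rw [integral_smul_nnreal_measure]
  simp [NNReal.smul_def]

/-- Comparison of the suprema of the quotients on the target and on the source. -/
theorem integral_divergence_mul_le (h : IsBiW1Infty F DF DFinv L) {ε : ℝ} (hε : 0 ≤ ε)
    (hDF : ∀ᵐ x ∂volume.restrict F.source, ‖DF x - ContinuousLinearMap.id ℝ (Space d)‖ ≤ ε)
    {q q' : Space d → ℝ} (hq' : MemLp q' 2 (volume.restrict F.source))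
    (hn : l2Norm F.source q' ≤ √((L : ℝ) ^ d) * l2Norm F.target q)
    (hdual : ∀ f : Space d → ℝ, Continuous f →
        ∫ y in F.target, f y * q y = ∫ x in F.source, f (F x) * q' x)
    {φ : Space d → Space d} (hφ : IsTestFunction F.target φ) :
    ∫ y in F.target, divergence (fderiv ℝ φ) y * q y ≤
      (sSup (quotients F.source q') * L + √d * ε) * (L : ℝ) ^ d * l2Norm F.target q *
        h1Seminorm F.target (fderiv ℝ φ) := by
  have hU := F.open_source
  have : IsFiniteMeasure (volume.restrict F.source) := ⟨by simpa using h.volume_source⟩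
  have hdφ : Continuous (fderiv ℝ φ) := hφ.contDiff.continuous_fderiv (by simp)
  have hdm : MemLp (fderiv ℝ φ) 2 (volume.restrict F.target) :=
    (hdφ.memLp_of_hasCompactSupport (hφ.hasCompactSupport.fderiv ℝ)).restrict _
  obtain ⟨C, hC⟩ := hdφ.bounded_above_of_compact_support (hφ.hasCompactSupport.fderiv ℝ)
  set S := sSup (quotients F.source q') with hS
  have hS0 : 0 ≤ S := sSup_quotients_nonneg hq'
  set A : Space d → Space d →L[ℝ] Space d := fun x => fderiv ℝ φ (F x) with hA
  have hAm : MemLp A 2 (volume.restrict F.source) :=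
    MemLp.of_bound ((hdφ.comp_continuousOn F.continuousOn).aestronglyMeasurable hU.measurableSet)
      C (Eventually.of_forall fun x => hC _)
  have hH := h.isH10_comp hφ
  set G := F.source.indicator fun x => fderiv ℝ φ (F x) ∘L DF x with hG
  have hGA : ∀ᵐ x ∂volume.restrict F.source, G x = A x ∘L DF x := by
    filter_upwards [ae_restrict_mem hU.measurableSet] with x hx
    simp [hG, hA, hx]
  set a := √(∫ x in F.source, frobSq (A x)) with ha
  set n' := l2Norm F.source q' with hn'
  have ha0 : 0 ≤ a := Real.sqrt_nonneg _
  have hn'0 : 0 ≤ n' := l2Norm_nonneg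
  have hGa : h1Seminorm F.source G ≤ L * a := by
    rw [h1Seminorm_eq hH.memLp_jacobian, ha, ← Real.sqrt_sq (NNReal.coe_nonneg L),
      ← Real.sqrt_mul (by positivity), ← integral_const_mul]
    refine Real.sqrt_le_sqrt (integral_mono_ae (integrable_frobSq hH.memLp_jacobian)
      ((integrable_frobSq hAm).const_mul _) ?_)
    filter_upwards [hGA, h.norm_le] with x hx hx'
    rw [hx]
    refine (frobSq_comp_le _ _).trans (mul_le_mul_of_nonneg_right ?_ (frobSq_nonneg _))
    gcongr
  have haV : a ≤ √((L : ℝ) ^ d) * h1Seminorm F.target (fderiv ℝ φ) := by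
    rw [h1Seminorm_eq hdm, ← Real.sqrt_mul (by positivity)]
    exact Real.sqrt_le_sqrt (h.integral_frobSq_comp_le hφ)
  have hGAm : MemLp (G - A) 2 (volume.restrict F.source) := hH.memLp_jacobian.sub hAm
  -- The first term pairs `q'` with the pulled-back field; the second contains `tr (A ∘ (DF - I))`
  -- and is the error.
  have hsplit : ∫ y in F.target, divergence (fderiv ℝ φ) y * q y =
      (∫ x in F.source, divergence G x * q' x) -
        ∫ x in F.source, divergence (G - A) x * q' x := by
    refine Eq.trans ?_ (integral_sub ((memLp_divergence hH.memLp_jacobian).integrable_mul hq')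
      ((memLp_divergence hGAm).integrable_mul hq'))
    refine (hdual (divergence (fderiv ℝ φ)) (continuous_tr.comp hdφ)).trans
      (integral_congr_ae (Eventually.of_forall fun x => ?_))
    change tr (A x) * q' x = tr (G x) * q' x - tr (G x - A x) * q' x
    rw [tr_sub]; ring
  have herr : |∫ x in F.source, divergence (G - A) x * q' x| ≤ √d * ε * (a * n') := by
    have hsm := memLp_sqrt_frobSq hAm
    calc |∫ x in F.source, divergence (G - A) x * q' x|
        ≤ ∫ x in F.source, |divergence (G - A) x * q' x| := abs_integral_le_integral_abs
      _ ≤ ∫ x in F.source, √d * ε * (|√(frobSq (A x))| * |q' x|) := by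
          refine integral_mono_ae ((memLp_divergence hGAm).integrable_mul hq').abs
            ((hsm.abs.integrable_mul hq'.abs).const_mul _) ?_
          filter_upwards [hGA, hDF] with x hx hx'
          have e1 : divergence (G - A) x =
              tr (A x ∘L (DF x - ContinuousLinearMap.id ℝ (Space d))) := by
            change tr (G x - A x) = _
            rw [hx, ContinuousLinearMap.comp_sub, ContinuousLinearMap.comp_id]
          rw [abs_mul, e1, ← mul_assoc, abs_of_nonneg (Real.sqrt_nonneg (frobSq (A x)))]
          refine mul_le_mul_of_nonneg_right ((abs_tr_comp_le _ _).trans ?_) (abs_nonneg _)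
          gcongr
      _ = √d * ε * ∫ x in F.source, |√(frobSq (A x))| * |q' x| := integral_const_mul _ _
      _ ≤ √d * ε * (a * n') := by
          refine mul_le_mul_of_nonneg_left ((integral_mul_le_sqrt hsm hq').trans_eq ?_)
            (by positivity)
          simp only [Real.sq_sqrt (frobSq_nonneg _), ha, hn', l2Norm]
  have hmain := integral_divergence_mul_le_sSup hq' hH
  -- One factor `√(L ^ d)` comes from the seminorm of the field, the other from the norm of `q'`.
  have hsq : √((L : ℝ) ^ d) * √((L : ℝ) ^ d) = (L : ℝ) ^ d := Real.mul_self_sqrt (by positivity)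
  have hL : (0 : ℝ) ≤ L := L.coe_nonneg
  calc _ ≤ S * (h1Seminorm F.source G * n') + √d * ε * (a * n') := by
        rw [hsplit]
        have := neg_abs_le (∫ x in F.source, divergence (G - A) x * q' x)
        linarith
    _ ≤ S * ((L * a) * n') + √d * ε * (a * n') := by gcongr
    _ = (S * L + √d * ε) * (a * n') := by ring
    _ ≤ (S * L + √d * ε) * ((√((L : ℝ) ^ d) * h1Seminorm F.target (fderiv ℝ φ)) *
          (√((L : ℝ) ^ d) * l2Norm F.target q)) := by
        gcongr
        exact mul_nonneg (Real.sqrt_nonneg _) h1Seminorm_nonneg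
    _ = (S * L + √d * ε) * (√((L : ℝ) ^ d) * √((L : ℝ) ^ d)) * l2Norm F.target q *
          h1Seminorm F.target (fderiv ℝ φ) := by ring
    _ = _ := by rw [hsq]

/-- Every competitor `q'` on the source yields a competitor on the target with almost the same
supremum. The relative error becomes absolute because the suprema are at most `√d`. -/
theorem beta_target_le (h : IsBiW1Infty F DF DFinv L) {ε : ℝ} (hε : 0 ≤ ε) (hε1 : ε ≤ 1)
    (hL : (L : ℝ) = 1 + ε)
    (hDF : ∀ᵐ x ∂volume.restrict F.source, ‖DF x - ContinuousLinearMap.id ℝ (Space d)‖ ≤ ε) :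
    beta F.target ≤ beta F.source + √d * 2 ^ (d + 2) * ε := by
  have hLpos : (0 : ℝ) < L := by rw [hL]; positivity
  by_cases hne : ∃ q', IsL2MeanZero F.source q' ∧ l2Norm F.source q' ≠ 0
  · rw [← sub_le_iff_le_add]
    obtain ⟨q₀, hq₀, h₀⟩ := hne
    refine le_csInf ⟨_, q₀, hq₀, h₀, rfl⟩ ?_
    rintro s ⟨q', hq', h0, rfl⟩
    obtain ⟨q, hq, hn, hdual⟩ := h.exists_transport hq'
    have hq0 : l2Norm F.target q ≠ 0 := by
      intro hz
      rw [hz, mul_zero] at hn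
      exact h0 (le_antisymm hn l2Norm_nonneg)
    set S := sSup (quotients F.source q') with hS
    have hS0 : 0 ≤ S := sSup_quotients_nonneg hq'.memLp
    have hSd : S ≤ √d := sSup_quotients_le hq'.memLp
    have h1 : sSup (quotients F.target q) ≤ (S * L + √d * ε) * (L : ℝ) ^ d := by
      refine Real.sSup_le ?_ (by positivity)
      rintro r ⟨v, G, hv, hG0, rfl⟩
      refine div_le_of_le_mul₀ (mul_nonneg h1Seminorm_nonneg l2Norm_nonneg) (by positivity) ?_
      refine (integral_divergence_mul_le_of_test hq.memLp (fun φ hφ =>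
        h.integral_divergence_mul_le hε hDF hq'.memLp hn hdual hφ) hv).trans_eq ?_
      ring
    -- This is the chord bound for the convex function `(1 + ε) ^ n` on `[0, 1]`.
    have hpow : ∀ n : ℕ, (1 + ε) ^ n ≤ 1 + (2 ^ n - 1) * ε := by
      intro n
      induction n with
      | zero => simp
      | succ n ih =>
        have h2 : (0 : ℝ) ≤ 2 ^ n - 1 := sub_nonneg.2 (one_le_pow₀ (by norm_num))
        calc (1 + ε) ^ (n + 1) = (1 + ε) ^ n * (1 + ε) := pow_succ _ _
          _ ≤ (1 + (2 ^ n - 1) * ε) * (1 + ε) := by gcongr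
          _ ≤ 1 + (2 ^ (n + 1) - 1) * ε := by
            rw [pow_succ]
            nlinarith [mul_nonneg (mul_nonneg h2 hε) (sub_nonneg.2 hε1)]
    have h2 : (1 + ε) ^ (d + 1) ≤ 1 + 2 ^ (d + 1) * ε :=
      (hpow _).trans (by nlinarith)
    have h3 : (1 + ε) ^ d ≤ 2 ^ d := pow_le_pow_left₀ (by positivity) (by linarith) d
    have h4 : (S * L + √d * ε) * (L : ℝ) ^ d ≤ S + √d * 2 ^ (d + 2) * ε := by
      rw [hL]
      calc (S * (1 + ε) + √d * ε) * (1 + ε) ^ d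
          = S * (1 + ε) ^ (d + 1) + √d * ε * (1 + ε) ^ d := by ring
        _ ≤ S * (1 + 2 ^ (d + 1) * ε) + √d * ε * 2 ^ d := by gcongr
        _ = S + S * (2 ^ (d + 1) * ε) + √d * ε * 2 ^ d := by ring
        _ ≤ S + √d * (2 ^ (d + 1) * ε) + √d * ε * 2 ^ (d + 1) := by
            gcongr <;> norm_num
        _ = S + √d * 2 ^ (d + 2) * ε := by ring
    have := beta_le_sSup hq hq0
    linarith
  -- Transport by the inverse sends a nonzero competitor on the target to one on the source, so here
  -- there is none and `beta F.target` is `sInf ∅ = 0`.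
  · have hempty : {s | ∃ q : Space d → ℝ, IsL2MeanZero F.target q ∧ l2Norm F.target q ≠ 0 ∧
        s = sSup (quotients F.target q)} = ∅ := by
      ext s
      simp only [Set.mem_ofPred_eq, Set.mem_empty_iff_false, iff_false]
      rintro ⟨q, hq, h0, -⟩
      obtain ⟨q', hq', hn, -⟩ := h.symm.exists_transport hq
      refine hne ⟨q', hq', fun hz => h0 ?_⟩
      have hn' : l2Norm F.target q ≤ √((L : ℝ) ^ d) * l2Norm F.source q' := hn
      rw [hz, mul_zero] at hn'
      exact le_antisymm hn' l2Norm_nonneg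
    have hz : beta F.target = 0 := by rw [beta, hempty, Real.sInf_empty]
    rw [hz]
    have := beta_nonneg F.source
    positivity

end IsBiW1Infty

theorem ae_norm_le_of_eLpNorm_top {α W : Type*} [MeasurableSpace α] [NormedAddCommGroup W]
    {μ : Measure α} {f : α → W} {ε : ℝ} (hε : 0 ≤ ε) (h : eLpNorm f ⊤ μ ≤ ENNReal.ofReal ε) :
    ∀ᵐ x ∂μ, ‖f x‖ ≤ ε := by
  rw [eLpNorm_exponent_top] at h
  filter_upwards [ae_le_eLpNormEssSup (f := f) (μ := μ)] with x hx
  rw [← ENNReal.ofReal_le_ofReal_iff hε, ofReal_norm]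
  exact hx.trans h

theorem norm_le_of_norm_sub_id_le {A : Space d →L[ℝ] Space d} {ε : ℝ}
    (h : ‖A - ContinuousLinearMap.id ℝ (Space d)‖ ≤ ε) : ‖A‖ ≤ 1 + ε := by
  have h1 := norm_add_le (ContinuousLinearMap.id ℝ (Space d)) (A - ContinuousLinearMap.id ℝ (Space d))
  rw [add_sub_cancel] at h1
  exact h1.trans (add_le_add ContinuousLinearMap.norm_id_le h)

end

end LBB

end

theorem theoremT (d : ℕ) (hd : 1 ≤ d) :
    ∃ c : ℝ, ∀ (Ω Ω' : Set (LBB.Space d)) (ε : ℝ),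
      LBB.IsBoundedLipschitzDomain Ω → LBB.IsBoundedLipschitzDomain Ω' → 0 < ε →
      LBB.LipschitzClose ε Ω Ω' →
      |LBB.beta Ω - LBB.beta Ω'| ≤ c * ε := by
  refine ⟨√d * 2 ^ (d + 2), fun Ω Ω' ε hΩ hΩ' hε hclose => ?_⟩
  rcases le_total ε 1 with hε1 | hε1
  · obtain ⟨F, DF, DFinv, rfl, rfl, hF, hDF, hFi, hDFi⟩ := hclose
    have e1 := LBB.ae_norm_le_of_eLpNorm_top hε.le hDF
    have e2 := LBB.ae_norm_le_of_eLpNorm_top hε.le hDFi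
    have h : LBB.IsBiW1Infty F DF DFinv ⟨1 + ε, by positivity⟩ :=
      ⟨hΩ'.isBounded.measure_lt_top, hΩ.isBounded.measure_lt_top, hF, hFi,
        e1.mono fun x hx => LBB.norm_le_of_norm_sub_id_le hx,
        e2.mono fun x hx => LBB.norm_le_of_norm_sub_id_le hx⟩
    have b1 := h.beta_target_le hε.le hε1 rfl e1
    have b2 : LBB.beta F.source ≤ LBB.beta F.target + √d * 2 ^ (d + 2) * ε :=
      h.symm.beta_target_le hε.le hε1 rfl e2
    rw [abs_le]
    constructor <;> linarith
  -- For `ε ≥ 1` both constants lie in `[0, √d]`, and the factor `2 ^ (d + 2) * ε` is at least `1`.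
  · have h1 : |LBB.beta Ω - LBB.beta Ω'| ≤ √d := by
      have := LBB.beta_nonneg Ω
      have := LBB.beta_nonneg Ω'
      have := LBB.beta_le Ω
      have := LBB.beta_le Ω'
      rw [abs_le]
      constructor <;> linarith
    refine h1.trans ?_
    rw [mul_assoc]
    refine le_mul_of_one_le_right (Real.sqrt_nonneg _) ?_
    exact one_le_mul_of_one_le_of_one_le (one_le_pow₀ (by norm_num)) hε1
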